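/- Let $\times$ be the cross product of $\mathbb{R}^7$, i.e. the bilinear alternating product with $\mathbf e_1\times\mathbf e_2=\mathbf e_3$, $\mathbf e_1\times\mathbf e_4=\mathbf e_5$, $\mathbf e_1\times\mathbf e_6=-\mathbf e_7$, $\mathbf e_2\times\mathbf e_4=\mathbf e_6$, $\mathbf e_2\times\mathbf e_5=\mathbf e_7$, $\mathbf e_3\times\mathbf e_4=\mathbf e_7$, $\mathbf e_3\times\mathbf e_5=-\mathbf e_6$ and their cyclic permutations. A $3$-dimensional subspace $V\subset\mathbb{R}^7$ is an associative $3$-plane if $V\times V\subset V$; then $V^\perp$ is called a coassociative $4$-plane. Let $\Sigma$ be a (connected) Riemann surface, let $\varphi:\Sigma\to S^6\subset\mathbb{R}^7$ be a smooth conformal harmonic immersion, and let $F:\Sigma\to\mathbb{R}^7$ be a smooth map with $dF=\varphi\times *d\varphi$, that is, $F_x=\varphi\times\varphi_y$ and $F_y=-\varphi\times\varphi_x$ in every local holomorphic coordinate $z=x+iy$. (Such an $F$ exists, and is unique up to translation, if $\Sigma$ is simply connected; it is an immersion.) Let $\mathbf{I}_F$ and $\mathbf{I\!I}_F$ be the first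 and the (vector-valued) second fundamental forms of $F$ and $\mathbf h_F=\frac12\operatorname{tr}\mathbf I_F^{-1}\mathbf{I\!I}_F$ its mean curvature vector. $F$ has parallel mean curvature vector if the normal part of $d\mathbf h_F$ vanishes, and $F$ is pseudo-umbilical if $\mathbf{I\!I}_F\cdot\mathbf h_F=\lambda\,\mathbf I_F$ for some smooth function $\lambda$ on $\Sigma$. The harmonic sequence $\varphi_0,\varphi_1,\varphi_2,\dots$ of $\varphi$ consists of the subbundles of $\Sigma\times\mathbb{C}^7$ such that $\varphi_0$ is spanned by $\varphi$ and $\varphi_{j+1}$ is the image of $v\mapsto P^{\perp}_{\varphi_j}(\partial v/\partial z)$ on sections $v$ of $\varphi_j$, extended across its isolated singularities, where $P^\perp_{\varphi_j}$ is the Hermitian projection onto the orthogonal complement of $\varphi_j$. The map $\varphi$ has isotropy order $r>0$ if $\varphi_0$ is Hermitian orthogonal to $\varphi_i$ for $0<i\le r$ but not to $\varphi_{r+1}$. If $W\subset\mathbb{R}^7$ is an $(m+1)$-dimensional subspace, $\varphi$ is superconformal in $S^m=S^6\cap W$ if $\varphi(\Sigma)\subset W$ and $\varphi$ has isotropy order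 $m$. **Theorem.** $F$ has parallel mean curvature vector and is not pseudo-umbilical if and only if there is a coassociative $4$-plane $W$ such that $\varphi$ is superconformal in the $3$-sphere $S^3=S^6\cap W$. Moreover, for every such $W$, the subspace $W^\perp$ is an associative $3$-plane and $F$ is, up to translation, an immersed surface in $W^\perp$ of constant mean curvature: $F-\mathbf c$ takes values in $W^\perp$ for some $\mathbf c\in\mathbb{R}^7$, and there are a smooth unit normal field $N:\Sigma\to W^\perp$ of $F$ and a constant $H\in\mathbb{R}$ with $\mathbf h_F=H N$. -/

import Mathlib

open scoped Manifold ContDiff Topology InnerProductSpace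

noncomputable section

namespace SevenDim

/-- Euclidean seven-space. -/
abbrev R7 : Type := EuclideanSpace ℝ (Fin 7)

/-- Its complexification, with the standard Hermitian inner product. -/
abbrev C7 : Type := EuclideanSpace ℂ (Fin 7)

/-- The inclusion of `R7` in `C7`. -/
def toC7 (x : R7) : C7 := WithLp.toLp 2 (fun i => (x i : ℂ))

/-- The seven-dimensional cross product. With the canonical basis numbered `e₁, …, e₇` (so that
`x 0` is the coefficient of `e₁`), it is the bilinear alternating product with
`e₁ × e₂ = e₃`, `e₁ × e₄ = e₅`, `e₁ × e₆ = - e₇`, `e₂ × e₄ = e₆`, `e₂ × e₅ = e₇`,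
`e₃ × e₄ = e₇`, `e₃ × e₅ = - e₆` and their cyclic permutations. -/
def cross (x y : R7) : R7 :=
  !₂[(x 1 * y 2 - x 2 * y 1) + (x 3 * y 4 - x 4 * y 3) - (x 5 * y 6 - x 6 * y 5),
     -(x 0 * y 2 - x 2 * y 0) + (x 3 * y 5 - x 5 * y 3) + (x 4 * y 6 - x 6 * y 4),
     (x 0 * y 1 - x 1 * y 0) + (x 3 * y 6 - x 6 * y 3) - (x 4 * y 5 - x 5 * y 4),
     -(x 0 * y 4 - x 4 * y 0) - (x 1 * y 5 - x 5 * y 1) - (x 2 * y 6 - x 6 * y 2),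
     (x 0 * y 3 - x 3 * y 0) - (x 1 * y 6 - x 6 * y 1) + (x 2 * y 5 - x 5 * y 2),
     (x 0 * y 6 - x 6 * y 0) + (x 1 * y 3 - x 3 * y 1) - (x 2 * y 4 - x 4 * y 2),
     -(x 0 * y 5 - x 5 * y 0) + (x 1 * y 4 - x 4 * y 1) + (x 2 * y 3 - x 3 * y 2)]

/-- An associative `3`-plane: a `3`-dimensional subspace closed under the cross product. -/
def IsAssociative (V : Submodule ℝ R7) : Prop :=
  Module.finrank ℝ V = 3 ∧ ∀ x ∈ V, ∀ y ∈ V, cross x y ∈ V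

/-- A coassociative `4`-plane: the orthogonal complement of an associative `3`-plane. -/
def IsCoassociative (W : Submodule ℝ R7) : Prop := IsAssociative Wᗮ

/-! ### Surfaces in `R7` in a coordinate `z = x + i y`

Here `f : ℂ → R7` is a map of a coordinate domain; `fderiv ℝ f z 1` is `f_x` and
`fderiv ℝ f z Complex.I` is `f_y`. -/

/-- Orthogonal projection of `R7` onto the normal space of `f` at `z`. -/
def normalProj (f : ℂ → R7) (z : ℂ) : R7 →L[ℝ] R7 :=
  ((fderiv ℝ f z).rangeᗮ).starProjection

/-- First fundamental form. -/
def firstFF (f : ℂ → R7) (z u v : ℂ) : ℝ := ⟪fderiv ℝ f z u, fderiv ℝ f z v⟫_ℝ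

/-- Vector valued second fundamental form: normal part of the second derivative. -/
def secondFF (f : ℂ → R7) (z u v : ℂ) : R7 :=
  normalProj f z (fderiv ℝ (fun ζ => fderiv ℝ f ζ v) z u)

/-- Mean curvature vector, `1/2 tr (I⁻¹ II)`, with the inverse of the `2 × 2` matrix of the first
fundamental form written out. -/
def meanCurv (f : ℂ → R7) (z : ℂ) : R7 :=
  (1 / (2 * (firstFF f z 1 1 * firstFF f z Complex.I Complex.I
      - firstFF f z 1 Complex.I ^ 2))) •
    (firstFF f z Complex.I Complex.I • secondFF f z 1 1
      - (2 * firstFF f z 1 Complex.I) • secondFF f z 1 Complex.I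
      + firstFF f z 1 1 • secondFF f z Complex.I Complex.I)

/-! ### Harmonic sequence in a coordinate -/

/-- The derivative `∂s/∂z = (s_x - i s_y) / 2`. -/
def dz (s : ℂ → C7) (z : ℂ) : C7 :=
  (1 / 2 : ℂ) • (fderiv ℝ s z 1 - Complex.I • fderiv ℝ s z Complex.I)

/-- The image at `z` of the second fundamental form `v ↦ P^⊥ (∂v/∂z)` of a bundle `L` of subspaces
of `C7`, where `v` runs over the smooth sections of `L` near `z` and `P^⊥` is the Hermitian
projection onto the orthogonal complement of `L`. -/
def imageA (L : ℂ → Submodule ℂ C7) (z : ℂ) : Submodule ℂ C7 :=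
  Submodule.span ℂ {w | ∃ s : ℂ → C7, ContDiffAt ℝ ∞ s z ∧ (∀ᶠ ζ in 𝓝 z, s ζ ∈ L ζ) ∧
    w = ((L z)ᗮ).starProjection (dz s z)}

/-- The next bundle of the harmonic sequence: the image of the second fundamental form with
singularities removed. The fibre at `z` is the limit, as `ζ → z` with `ζ ≠ z`, of the images
at `ζ`, that is, it consists of the `w` whose distance to the image at `ζ` tends to `0`. -/
def nextBundle (L : ℂ → Submodule ℂ C7) (z : ℂ) : Submodule ℂ C7 where
  carrier := {w | Filter.Tendsto (fun ζ => (imageA L ζ).starProjection w) (𝓝[≠] z) (𝓝 w)}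
  add_mem' := by
    intro a b ha hb
    simpa only [Set.mem_ofPred_eq, map_add] using Filter.Tendsto.add ha hb
  zero_mem' := by
    simp only [Set.mem_ofPred_eq, map_zero]
    exact tendsto_const_nhds
  smul_mem' := by
    intro c a ha
    simpa only [Set.mem_ofPred_eq, map_smul] using Filter.Tendsto.const_smul ha c

/-- The elements `φ_0, φ_1, φ_2, …` of the harmonic sequence of `f`, where `f` is viewed as a map
into the complex projective space of `C7`, so that `φ_0` is the line bundle spanned by `f`. -/
def harmonicSeq (f : ℂ → R7) : ℕ → ℂ → Submodule ℂ C7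
  | 0 => fun z => Submodule.span ℂ {toC7 (f z)}
  | j + 1 => nextBundle (harmonicSeq f j)

/-! ### Maps of a Riemann surface

`S` is a Riemann surface; `e` runs over its holomorphic charts, and `g ∘ e.symm` is the expression
of the map `g` in the coordinate `e`. All notions are independent of the holomorphic coordinate. -/

variable {S : Type*} [TopologicalSpace S] [ChartedSpace ℂ S]

/-- `φ` is an immersion. -/
def IsImmersed (φ : S → R7) : Prop :=
  ∀ e ∈ atlas ℂ S, ∀ z ∈ e.target, Function.Injective (fderiv ℝ (φ ∘ e.symm) z)

/-- `φ` is (weakly) conformal: `|φ_x| = |φ_y|` and `φ_x · φ_y = 0`. -/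
def IsConformalMap (φ : S → R7) : Prop :=
  ∀ e ∈ atlas ℂ S, ∀ z ∈ e.target,
    ‖fderiv ℝ (φ ∘ e.symm) z 1‖ = ‖fderiv ℝ (φ ∘ e.symm) z Complex.I‖ ∧
    ⟪fderiv ℝ (φ ∘ e.symm) z 1, fderiv ℝ (φ ∘ e.symm) z Complex.I⟫_ℝ = 0

/-- `φ` is a harmonic map into the unit sphere: its Laplacian is orthogonal to
the tangent space `{u | φ · u = 0}` of the sphere. -/
def IsHarmonicToSphere (φ : S → R7) : Prop :=
  ∀ e ∈ atlas ℂ S, ∀ z ∈ e.target, ∀ u : R7, ⟪φ (e.symm z), u⟫_ℝ = 0 →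
    ⟪Laplacian.laplacian (φ ∘ e.symm) z, u⟫_ℝ = 0

/-- `φ` is a (smooth) conformal harmonic immersion into the unit sphere `S⁶`. -/
structure IsConformalHarmonicImmersion (φ : S → R7) : Prop where
  smooth : ContMDiff 𝓘(ℝ, ℂ) 𝓘(ℝ, R7) ∞ φ
  mem_sphere : ∀ p, φ p ∈ Metric.sphere (0 : R7) 1
  immersed : IsImmersed φ
  conformal : IsConformalMap φ
  harmonic : IsHarmonicToSphere φ

/-- `F` is a surface associated to `φ`: `dF = φ × *dφ`, where `*α = α ∘ J`, that is,
`F_x = φ × φ_y` and `F_y = - φ × φ_x`. -/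
structure IsAssociatedSurface (φ F : S → R7) : Prop where
  smooth : ContMDiff 𝓘(ℝ, ℂ) 𝓘(ℝ, R7) ∞ F
  deriv_eq : ∀ e ∈ atlas ℂ S, ∀ z ∈ e.target, ∀ v : ℂ,
    fderiv ℝ (F ∘ e.symm) z v =
      cross (φ (e.symm z)) (fderiv ℝ (φ ∘ e.symm) z (Complex.I * v))

/-- The mean curvature vector of `F` is parallel in the normal bundle: the normal part of its
derivative vanishes. -/
def HasParallelMeanCurvature (F : S → R7) : Prop :=
  ∀ e ∈ atlas ℂ S, ∀ z ∈ e.target, ∀ v : ℂ,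
    normalProj (F ∘ e.symm) z (fderiv ℝ (meanCurv (F ∘ e.symm)) z v) = 0

/-- `F` is pseudo-umbilical: `II · h = lam I` for some smooth function `lam`. -/
def IsPseudoUmbilical (F : S → R7) : Prop :=
  ∃ lam : S → ℝ, ContMDiff 𝓘(ℝ, ℂ) 𝓘(ℝ, ℝ) ∞ lam ∧
    ∀ e ∈ atlas ℂ S, ∀ z ∈ e.target, ∀ u v : ℂ,
      ⟪secondFF (F ∘ e.symm) z u v, meanCurv (F ∘ e.symm) z⟫_ℝ =
        lam (e.symm z) * firstFF (F ∘ e.symm) z u v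

/-- The bundle spanned by `φ` is Hermitian orthogonal to the `i`-th element of the harmonic
sequence of `φ`. -/
def PerpHarmonicSeq (φ : S → R7) (i : ℕ) : Prop :=
  ∀ e ∈ atlas ℂ S, ∀ z ∈ e.target, ∀ w ∈ harmonicSeq (φ ∘ e.symm) i z,
    ⟪toC7 (φ (e.symm z)), w⟫_ℂ = 0

/-- `φ` has isotropy order `r > 0`. -/
def HasIsotropyOrder (φ : S → R7) (r : ℕ) : Prop :=
  0 < r ∧ (∀ i, 0 < i → i ≤ r → PerpHarmonicSeq φ i) ∧ ¬ PerpHarmonicSeq φ (r + 1)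

/-- The harmonic map `φ` is superconformal in the unit sphere `S^m` of the `(m+1)`-dimensional
subspace `W`: it takes values in `W` and has isotropy order `m`. -/
def IsSuperconformalIn (φ : S → R7) (W : Submodule ℝ R7) : Prop :=
  (∀ p, φ p ∈ W) ∧ ∃ m : ℕ, Module.finrank ℝ W = m + 1 ∧ HasIsotropyOrder φ m

/-- Up to translation, `F` is an immersed surface of constant mean curvature in the
`3`-dimensional subspace `V`: it has a smooth unit normal field `N` in `V` with respect to which
the (scalar) mean curvature is constant. -/
def IsCMCInUpToTranslation (F : S → R7) (V : Submodule ℝ R7) : Prop :=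
  Module.finrank ℝ V = 3 ∧ IsImmersed F ∧ (∃ c : R7, ∀ p, F p - c ∈ V) ∧
    ∃ (N : S → R7) (H : ℝ), ContMDiff 𝓘(ℝ, ℂ) 𝓘(ℝ, R7) ∞ N ∧
      (∀ p, N p ∈ V ∧ ‖N p‖ = 1) ∧
      ∀ e ∈ atlas ℂ S, ∀ z ∈ e.target,
        (∀ v : ℂ, ⟪fderiv ℝ (F ∘ e.symm) z v, N (e.symm z)⟫_ℝ = 0) ∧
        meanCurv (F ∘ e.symm) z = H • N (e.symm z)

end SevenDim

end

noncomputable section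

namespace SevenDim

open Complex (I)

/-! ### The cross product -/

/-! In a holomorphic coordinate write `f`, `g` for `φ`, `F` and put `E = |f_x|²`. From `g_x = f ×
f_y` and `g_y = -f × f_x`, the map `g` is conformal with the same factor `E`, and its Laplacian is
`2 f_x × f_y`. So the mean curvature vector is `N = (f_x × f_y) / E`, which is automatically a unit
vector (`meanCurv_eq`). Let `P - iR` be the coefficient of the Hopf differential of `g` in the
direction `N`.

Suppose that `N` is parallel, so that `N_x` and `N_y` are tangent to `g`. The Codazzi equations make
`P - iR` holomorphic (`differentiableOn_hopf`). Where it vanishes, `F + N` has zero derivative. By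
the identity theorem the set where `F + N` is locally constant is open and closed. If it is
everything, `F` is pseudo-umbilical; otherwise it is empty and the points with `P² + R² ≠ 0` are
dense (`frequently_not_umbilic`). At such a point the derivatives of `E N = f_x × f_y`, together
with the symmetry of the second derivatives of `N`, force `f ⟂ N` and determine the second
fundamental form of `f`: it points along `N × f`, with coefficients `-R` and `P`
(`eq_of_not_umbilic`, `structure_eq`). Then `g_x`, `g_y`, `N` span an associative plane and their
derivatives stay in it. By density the plane is constant (`projSq_const`), and `f` is orthogonal to
it (`exists_coassociative`).

The isotropy order is read off from the harmonic sequence. For every conformal harmonic immersion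
`φ_0` is orthogonal to `φ_1`, `φ_2`, `φ_3` (`perp_three`). Where `P² + R² ≠ 0` the sequence is
spanned by `f`, `f_z`, `N × f`, the conjugate of `f_z`, and `f` again (`harmonicSeq_four`), so the
order is exactly `3`.

Conversely, let `φ` lie in a coassociative `W`. Products of vectors of `W` lie in `Wᗮ`
(`IsCoassociative.cross_mem`), so `g_x`, `g_y`, `N` form a frame of the fixed three-space `Wᗮ`. As
`N` has length one, its derivative is tangent to `g`: the mean curvature vector is parallel and `F`
has constant mean curvature `1` in a translate of `Wᗮ`. If `F` were pseudo-umbilical, `P = R = 0`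
would make `f` totally geodesic in the three-sphere; then `φ_2`, hence `φ_4`, would vanish, against
isotropy order `3` (`not_isPseudoUmbilical`). -/

/-- The cross product as a continuous bilinear map. -/
def crossL : R7 →L[ℝ] R7 →L[ℝ] R7 :=
  LinearMap.toContinuousBilinearMap <| LinearMap.mk₂ ℝ cross
    (fun x y z => by ext i; fin_cases i <;> simp [cross] <;> ring)
    (fun c x y => by ext i; fin_cases i <;> simp [cross] <;> ring)
    (fun x y z => by ext i; fin_cases i <;> simp [cross] <;> ring)
    (fun c x y => by ext i; fin_cases i <;> simp [cross] <;> ring)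

theorem crossL_apply (x y : R7) : crossL x y = cross x y := rfl

theorem cross_add_left (x y z : R7) : cross (x + y) z = cross x z + cross y z := by
  simp [← crossL_apply]

theorem cross_add_right (x y z : R7) : cross x (y + z) = cross x y + cross x z := by
  simp [← crossL_apply]

theorem cross_sub_left (x y z : R7) : cross (x - y) z = cross x z - cross y z := by
  simp [← crossL_apply]

theorem cross_sub_right (x y z : R7) : cross x (y - z) = cross x y - cross x z := by
  simp [← crossL_apply]

theorem cross_neg_right (x y : R7) : cross x (-y) = -cross x y := by
  simp [← crossL_apply]

theorem cross_smul_left (c : ℝ) (x y : R7) : cross (c • x) y = c • cross x y := by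
  simp [← crossL_apply]

theorem cross_smul_right (c : ℝ) (x y : R7) : cross x (c • y) = c • cross x y := by
  simp [← crossL_apply]

theorem cross_zero_right (x : R7) : cross x 0 = 0 := by
  simp [← crossL_apply]

theorem cross_self (x : R7) : cross x x = 0 := by
  ext i; fin_cases i <;> simp [cross] <;> ring

theorem cross_comm (x y : R7) : cross x y = -cross y x := by
  ext i; fin_cases i <;> simp [cross] <;> ring

theorem inner_eq_sum (x y : R7) : ⟪x, y⟫_ℝ = x 0 * y 0 + x 1 * y 1 + x 2 * y 2 + x 3 * y 3 +
    x 4 * y 4 + x 5 * y 5 + x 6 * y 6 := by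
  simp [PiLp.inner_apply, Fin.sum_univ_seven, mul_comm]

theorem inner_cross_rotate (x y z : R7) : ⟪cross x y, z⟫_ℝ = ⟪x, cross y z⟫_ℝ := by
  simp only [inner_eq_sum]
  simp [cross]
  ring

theorem inner_cross_self_left (x y : R7) : ⟪cross x y, x⟫_ℝ = 0 := by
  rw [real_inner_comm, ← inner_cross_rotate, cross_self, inner_zero_left]

theorem inner_cross_self_right (x y : R7) : ⟪cross x y, y⟫_ℝ = 0 := by
  rw [inner_cross_rotate, cross_self, inner_zero_right]

theorem cross_cross_self (x y : R7) :
    cross x (cross x y) = ⟪x, y⟫_ℝ • x - ⟪x, x⟫_ℝ • y := by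
  ext i
  fin_cases i <;> simp only [inner_eq_sum] <;> simp [cross] <;> ring

/-- Polarisation of `cross_cross_self`. -/
theorem cross_cross_polar (x y z : R7) : cross x (cross y z) =
    -cross y (cross x z) + (⟪y, z⟫_ℝ • x + ⟪x, z⟫_ℝ • y - (2 * ⟪x, y⟫_ℝ) • z) := by
  ext i
  fin_cases i <;> simp only [inner_eq_sum] <;> simp [cross] <;> ring

/-- `x × ·` is skew-adjoint with square `y ↦ ⟪x, y⟫ x - |x|² y`. All lengths and angles of the frame
`p × a`, `p × b`, `a × b` come from this. -/
theorem inner_cross_cross (x y z : R7) :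
    ⟪cross x y, cross x z⟫_ℝ = ⟪x, x⟫_ℝ * ⟪y, z⟫_ℝ - ⟪x, y⟫_ℝ * ⟪x, z⟫_ℝ := by
  have h : ⟪cross x y, cross x z⟫_ℝ = -⟪cross x (cross x y), z⟫_ℝ := by
    rw [cross_comm x (cross x y), inner_neg_left, inner_cross_rotate (cross x y) x z, neg_neg]
  rw [h, cross_cross_self, inner_sub_left, inner_smul_left, inner_smul_left]
  simp

/-! ### Linear algebra of a conformal frame -/

/-- `p` is a unit vector and `a`, `b` are orthogonal tangent vectors of length `√E` at `p`. -/
structure ConformalFrame (p a b : R7) (E : ℝ) : Prop where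
  pos : 0 < E
  pp : ⟪p, p⟫_ℝ = 1
  aa : ⟪a, a⟫_ℝ = E
  bb : ⟪b, b⟫_ℝ = E
  ab : ⟪a, b⟫_ℝ = 0
  pa : ⟪p, a⟫_ℝ = 0
  pb : ⟪p, b⟫_ℝ = 0

namespace ConformalFrame

variable {p a b : R7} {E : ℝ}

theorem cross_cross (F : ConformalFrame p a b E) (v : R7) :
    cross p (cross p v) = ⟪p, v⟫_ℝ • p - v := by
  rw [cross_cross_self, F.pp, one_smul]

theorem inner_pa_pa (F : ConformalFrame p a b E) : ⟪cross p a, cross p a⟫_ℝ = E := by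
  rw [inner_cross_cross, F.pp, F.aa, F.pa]; ring

theorem inner_pb_pb (F : ConformalFrame p a b E) : ⟪cross p b, cross p b⟫_ℝ = E := by
  rw [inner_cross_cross, F.pp, F.bb, F.pb]; ring

theorem inner_pa_pb (F : ConformalFrame p a b E) : ⟪cross p a, cross p b⟫_ℝ = 0 := by
  rw [inner_cross_cross, F.pp, F.ab, F.pa]; ring

theorem inner_pa_ab (F : ConformalFrame p a b E) : ⟪cross p a, cross a b⟫_ℝ = 0 := by
  rw [cross_comm p a, inner_neg_left, inner_cross_cross, F.aa, F.ab, F.pb]; ring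

theorem inner_pb_ab (F : ConformalFrame p a b E) : ⟪cross p b, cross a b⟫_ℝ = 0 := by
  rw [cross_comm p b, cross_comm a b, inner_neg_left, inner_neg_right, inner_cross_cross, F.bb,
    real_inner_comm p b, F.pb, F.pa]; ring

theorem inner_ab_ab (F : ConformalFrame p a b E) : ⟪cross a b, cross a b⟫_ℝ = E * E := by
  rw [inner_cross_cross, F.aa, F.bb, F.ab]; ring

/-- The consequence of the structure equations of a surface with parallel mean curvature vector
at a point that is not umbilical with respect to the mean curvature vector. -/
theorem eq_of_not_umbilic (F : ConformalFrame p a b E) {α β : R7} {P R : ℝ}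
    (hα : ⟪p, α⟫_ℝ = -E) (hβ : ⟪p, β⟫_ℝ = 0)
    (h1 : ⟪b, β⟫_ℝ = ⟪a, α⟫_ℝ) (h2 : ⟪a, β⟫_ℝ = -⟪b, α⟫_ℝ)
    (H1 : cross α b + cross a β =
      (2 * ⟪a, α⟫_ℝ / E) • cross a b - (E + P) • cross p b + R • cross p a)
    (H2 : cross β b + cross a (-α - (2 * E) • p) =
      (2 * ⟪a, β⟫_ℝ / E) • cross a b - R • cross p b + (E - P) • cross p a)
    (H3 : ∀ u : R7, ⟪cross p a, u⟫_ℝ = 0 → ⟪cross p b, u⟫_ℝ = 0 →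
      ⟪cross p (P • α + R • β), u⟫_ℝ = 0)
    (hPR : P ^ 2 + R ^ 2 ≠ 0) :
    ⟪p, cross a b⟫_ℝ = 0 ∧
    α = -E • p + (⟪a, α⟫_ℝ / E) • a + (⟪b, α⟫_ℝ / E) • b - (R / E) • cross (cross a b) p ∧
    β = (⟪a, β⟫_ℝ / E) • a + (⟪b, β⟫_ℝ / E) • b + (P / E) • cross (cross a b) p := by
  have hE := F.pos.ne'
  set m := ⟪a, α⟫_ℝ with hm
  set n := ⟪b, α⟫_ℝ with hn
  -- `α'` and `β'` are the components of `α` and `β` orthogonal to `p`, `a`, `b`.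
  obtain ⟨α', hα'⟩ : ∃ α', α' = α + E • p - (m / E) • a - (n / E) • b := ⟨_, rfl⟩
  obtain ⟨β', hβ'⟩ : ∃ β', β' = β + (n / E) • a - (m / E) • b := ⟨_, rfl⟩
  have eα : α = α' - E • p + (m / E) • a + (n / E) • b := by rw [hα']; module
  have eβ : β = β' - (n / E) • a + (m / E) • b := by rw [hβ']; module
  have pα' : ⟪p, α'⟫_ℝ = 0 := by
    simp only [hα', inner_add_right, inner_sub_right, real_inner_smul_right, hα, F.pp, F.pa, F.pb]
    ring
  have pβ' : ⟪p, β'⟫_ℝ = 0 := by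
    simp only [hβ', inner_add_right, inner_sub_right, real_inner_smul_right, hβ, F.pa, F.pb]
    ring
  have ba : ⟪b, a⟫_ℝ = 0 := by rw [real_inner_comm, F.ab]
  have ap : ⟪a, p⟫_ℝ = 0 := by rw [real_inner_comm, F.pa]
  have bp : ⟪b, p⟫_ℝ = 0 := by rw [real_inner_comm, F.pb]
  have aα' : ⟪a, α'⟫_ℝ = 0 := by
    simp only [hα', inner_add_right, inner_sub_right, real_inner_smul_right, F.aa, F.ab, ap, ← hm]
    field_simp; ring
  have bα' : ⟪b, α'⟫_ℝ = 0 := by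
    simp only [hα', inner_add_right, inner_sub_right, real_inner_smul_right, F.bb, ba, bp, ← hn]
    field_simp; ring
  have aβ' : ⟪a, β'⟫_ℝ = 0 := by
    simp only [hβ', inner_add_right, inner_sub_right, real_inner_smul_right, F.aa, F.ab, h2]
    field_simp; ring
  have bβ' : ⟪b, β'⟫_ℝ = 0 := by
    simp only [hβ', inner_add_right, inner_sub_right, real_inner_smul_right, F.bb, ba, h1]
    field_simp; ring
  -- In `H1` and `H2` the parts of `α`, `β` along `p`, `a`, `b` cancel against the derivative of `E`
  -- and the terms in `E`.
  have K1 : cross α' b - cross β' a = R • cross p a - P • cross p b := by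
    rw [eα, eβ] at H1
    simp only [cross_add_left, cross_sub_left, cross_add_right, cross_sub_right, cross_smul_left,
      cross_smul_right, cross_self] at H1
    rw [cross_comm a β'] at H1
    linear_combination (norm := module) H1
  have K2 : cross β' b + cross α' a = -R • cross p b - P • cross p a := by
    rw [h2, eα, eβ] at H2
    simp only [cross_add_left, cross_sub_left, cross_add_right, cross_sub_right, cross_smul_left,
      cross_smul_right, cross_self, cross_neg_right] at H2
    rw [cross_comm a α', cross_comm a p] at H2
    linear_combination (norm := module) H2
  -- `p × (P α' + R β')` is orthogonal to `p × a` and `p × b`, so it may be taken for `u` in `H3`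
  -- and is then orthogonal to itself.
  have K3 : P • α' + R • β' = 0 := by
    have e : cross p (P • α + R • β) = cross p (P • α' + R • β')
        + ((P * m - R * n) / E) • cross p a + ((P * n + R * m) / E) • cross p b := by
      rw [eα, eβ]
      simp only [cross_add_right, cross_sub_right, cross_smul_right, cross_self]
      module
    have ua : ⟪cross p a, cross p (P • α' + R • β')⟫_ℝ = 0 := by
      rw [inner_cross_cross, inner_add_right, inner_smul_right, inner_smul_right, aα', aβ', F.pa]
      ring
    have ub : ⟪cross p b, cross p (P • α' + R • β')⟫_ℝ = 0 := by
      rw [inner_cross_cross, inner_add_right, inner_smul_right, inner_smul_right, bα', bβ', F.pb]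
      ring
    have := H3 _ ua ub
    rw [e, inner_add_left, inner_add_left, inner_smul_left, inner_smul_left, ua, ub] at this
    have z : cross p (P • α' + R • β') = 0 := by
      rw [← inner_self_eq_zero (𝕜 := ℝ)]; simpa using this
    have zz := F.cross_cross (P • α' + R • β')
    rw [z, cross_zero_right, inner_add_right, inner_smul_right, inner_smul_right, pα', pβ'] at zz
    linear_combination (norm := module) (1 : ℝ) • zz
  -- By `K3` the pair `(α', β')` is `(-R, P)` times one vector `Y`; it remains to identify `Y` as
  -- `((a × b) × p) / E`.
  obtain ⟨Y, hY⟩ : ∃ Y, Y = (P ^ 2 + R ^ 2)⁻¹ • (P • β' - R • α') := ⟨_, rfl⟩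
  have Yα : α' = -R • Y := by
    have : (P ^ 2 + R ^ 2) • α' = (P ^ 2 + R ^ 2) • (-R • Y) := by
      rw [hY, smul_comm _ (-R), smul_inv_smul₀ hPR]
      linear_combination (norm := module) P • K3
    exact smul_right_injective _ hPR this
  have Yβ : β' = P • Y := by
    have : (P ^ 2 + R ^ 2) • β' = (P ^ 2 + R ^ 2) • (P • Y) := by
      rw [hY, smul_comm _ P, smul_inv_smul₀ hPR]
      linear_combination (norm := module) R • K3
    exact smul_right_injective _ hPR this
  have Ya : cross Y a = cross p b := by
    rw [Yα, Yβ] at K1 K2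
    simp only [cross_smul_left] at K1 K2
    refine smul_right_injective _ hPR (?_ : (P ^ 2 + R ^ 2) • _ = (P ^ 2 + R ^ 2) • _)
    linear_combination (norm := module) (-P) • K1 - R • K2
  have apb : cross a (cross p b) = -cross p (cross a b) := by
    rw [cross_cross_polar, F.pb, F.ab, ap]; simp
  have aY : ⟪a, Y⟫_ℝ = 0 := by
    rw [hY, inner_smul_right, inner_sub_right, inner_smul_right, inner_smul_right, aα', aβ']; simp
  have EY : E • Y = cross (cross a b) p := by
    have := cross_cross_self a Y
    rw [cross_comm a Y, cross_neg_right, Ya, apb, aY, F.aa] at this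
    rw [cross_comm _ p]
    linear_combination (norm := module) (1 : ℝ) • this
  have YY : ⟪Y, Y⟫_ℝ = 1 := by
    have h := inner_cross_cross a Y Y
    rw [cross_comm a Y, inner_neg_neg, Ya, F.inner_pb_pb, F.aa, aY] at h
    have : E * (⟪Y, Y⟫_ℝ - 1) = 0 := by linarith
    have := (mul_eq_zero.1 this).resolve_left hE
    linarith
  refine ⟨?_, ?_, ?_⟩
  -- Since `|Y| = 1`, the vector `p × (a × b) = -E Y` is as long as `a × b`, and `p` is a unit
  -- vector: equality in `|p × w| ≤ |w|` means `p ⟂ w`.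
  · have h := inner_cross_cross p (cross a b) (cross a b)
    rw [cross_comm p, inner_neg_neg, ← EY, inner_smul_left, inner_smul_right, YY, F.pp,
      F.inner_ab_ab] at h
    have h : ⟪p, cross a b⟫_ℝ ^ 2 = 0 := by simp at h; linarith
    exact pow_eq_zero_iff two_ne_zero |>.1 h
  · have e : (R / E) • cross (cross a b) p = R • Y := by
      rw [← EY, smul_smul, div_mul_cancel₀ _ hE]
    rw [e]
    nth_rw 1 [eα]
    rw [Yα]; module
  · have e : (P / E) • cross (cross a b) p = P • Y := by
      rw [← EY, smul_smul, div_mul_cancel₀ _ hE]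
    rw [e, h1, h2]
    nth_rw 1 [eβ]
    rw [Yβ]; module

/-! ### The frame `p × a`, `p × b`, `a × b` and its associative span. -/

theorem cross_ab_a (F : ConformalFrame p a b E) : cross (cross a b) a = E • b := by
  rw [cross_comm, cross_cross_self, F.aa, F.ab]; module

theorem cross_ab_b (F : ConformalFrame p a b E) : cross (cross a b) b = -E • a := by
  rw [cross_comm, cross_comm a b, cross_neg_right, cross_cross_self, F.bb, real_inner_comm, F.ab]
  module

theorem cross_ab_pa (F : ConformalFrame p a b E) (h : ⟪p, cross a b⟫_ℝ = 0) :
    cross (cross a b) (cross p a) = -E • cross p b := by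
  rw [cross_cross_polar, F.cross_ab_a, F.pa, inner_cross_self_left, real_inner_comm, h,
    cross_smul_right]
  module

theorem cross_ab_pb (F : ConformalFrame p a b E) (h : ⟪p, cross a b⟫_ℝ = 0) :
    cross (cross a b) (cross p b) = E • cross p a := by
  rw [cross_cross_polar, F.cross_ab_b, F.pb, inner_cross_self_right, real_inner_comm, h,
    cross_smul_right]
  module

theorem cross_pa_pb (F : ConformalFrame p a b E) (h : ⟪p, cross a b⟫_ℝ = 0) :
    cross (cross p a) (cross p b) = -cross a b := by
  have hb : ⟪cross p a, b⟫_ℝ = 0 := by rw [inner_cross_rotate, h]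
  have hp : cross (cross p a) b = -cross p (cross a b) := by
    rw [cross_comm, cross_cross_polar, F.pa, real_inner_comm a b, F.ab, real_inner_comm p b, F.pb,
      cross_comm b a, cross_neg_right]
    module
  rw [cross_cross_polar, hp, F.pb, hb, inner_cross_self_left, cross_neg_right, F.cross_cross, h]
  module

theorem linearIndependent (F : ConformalFrame p a b E) :
    LinearIndependent ℝ ![cross p a, cross p b, cross a b] := by
  have hE := F.pos.ne'
  refine linearIndependent_of_ne_zero_of_inner_eq_zero (𝕜 := ℝ) ?_ ?_
  · intro i hi
    have h0 := inner_self_eq_zero (𝕜 := ℝ).2 hi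
    fin_cases i
    · exact hE (F.inner_pa_pa.symm.trans h0)
    · exact hE (F.inner_pb_pb.symm.trans h0)
    · exact (mul_ne_zero hE hE) (F.inner_ab_ab.symm.trans h0)
  · intro i j hij
    have h1 := F.inner_pa_pb
    have h2 := F.inner_pa_ab
    have h3 := F.inner_pb_ab
    have h1' := (real_inner_comm _ _).trans h1
    have h2' := (real_inner_comm _ _).trans h2
    have h3' := (real_inner_comm _ _).trans h3
    fin_cases i <;> fin_cases j <;> first | exact absurd rfl hij | assumption

theorem finrank_span (F : ConformalFrame p a b E) :
    Module.finrank ℝ (Submodule.span ℝ {cross p a, cross p b, cross a b}) = 3 := by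
  have h := finrank_span_eq_card F.linearIndependent
  have e : Set.range ![cross p a, cross p b, cross a b] =
      {cross p a, cross p b, cross a b} := by
    ext x
    simp
    tauto
  rw [e] at h
  simpa using h

theorem isAssociative (F : ConformalFrame p a b E) (h : ⟪p, cross a b⟫_ℝ = 0) :
    IsAssociative (Submodule.span ℝ {cross p a, cross p b, cross a b}) := by
  refine ⟨F.finrank_span, fun x hx y hy => ?_⟩
  obtain ⟨x₁, x₂, x₃, rfl⟩ := Submodule.mem_span_triple.1 hx
  obtain ⟨y₁, y₂, y₃, rfl⟩ := Submodule.mem_span_triple.1 hy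
  refine Submodule.mem_span_triple.2 ⟨(x₃ * y₂ - x₂ * y₃) * E, (x₁ * y₃ - x₃ * y₁) * E,
    x₂ * y₁ - x₁ * y₂, ?_⟩
  simp only [cross_add_left, cross_add_right, cross_smul_left, cross_smul_right, cross_self]
  rw [cross_comm (cross p a) (cross a b), cross_comm (cross p b) (cross a b),
    cross_comm (cross p b) (cross p a), F.cross_ab_pa h, F.cross_ab_pb h, F.cross_pa_pb h]
  module

/-- In a `3`-dimensional space containing the frame `p × a`, `p × b`, `a × b`, only zero is
orthogonal to the frame. -/
theorem eq_zero_of_mem (F : ConformalFrame p a b E) {V : Submodule ℝ R7}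
    (hV : Module.finrank ℝ V = 3) (h1 : cross p a ∈ V) (h2 : cross p b ∈ V)
    (h3 : cross a b ∈ V) {x : R7} (hx : x ∈ V) (hx1 : ⟪cross p a, x⟫_ℝ = 0)
    (hx2 : ⟪cross p b, x⟫_ℝ = 0) (hx3 : ⟪cross a b, x⟫_ℝ = 0) : x = 0 := by
  have hle : Submodule.span ℝ {cross p a, cross p b, cross a b} ≤ V := by
    rw [Submodule.span_le]
    rintro y (rfl | rfl | rfl) <;> assumption
  have he := Submodule.eq_of_le_of_finrank_eq hle (F.finrank_span.trans hV.symm)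
  rw [← he] at hx
  obtain ⟨c₁, c₂, c₃, rfl⟩ := Submodule.mem_span_triple.1 hx
  rw [← inner_self_eq_zero (𝕜 := ℝ)]
  nth_rw 1 [inner_add_left, inner_add_left]
  rw [real_inner_smul_left, real_inner_smul_left, real_inner_smul_left, hx1, hx2, hx3]
  ring

end ConformalFrame

/-! ### Coassociative planes -/

theorem IsAssociative.isCoassociative_orthogonal {V : Submodule ℝ R7} (hV : IsAssociative V) :
    IsCoassociative Vᗮ := by
  rwa [IsCoassociative, Submodule.orthogonal_orthogonal]

theorem IsCoassociative.finrank_eq {W : Submodule ℝ R7} (hW : IsCoassociative W) :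
    Module.finrank ℝ W = 4 := by
  have h := Submodule.finrank_add_finrank_orthogonal W
  rw [hW.1] at h
  simp at h
  omega

/-- The cross product of two vectors of a coassociative plane is orthogonal to the plane. -/
theorem IsCoassociative.cross_mem {W : Submodule ℝ R7} (hW : IsCoassociative W) {x y : R7}
    (hx : x ∈ W) (hy : y ∈ W) : cross x y ∈ Wᗮ := by
  rcases eq_or_ne x 0 with rfl | hx0
  · rw [cross_comm, cross_zero_right, neg_zero]; exact zero_mem _
  have hvx : ∀ v ∈ Wᗮ, cross x v ∈ W := by
    intro v hv
    rw [← Submodule.orthogonal_orthogonal W]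
    intro u hu
    rw [real_inner_comm, inner_cross_rotate]
    exact Submodule.inner_right_of_mem_orthogonal hx (hW.2 _ hv _ hu)
  have hxx : ⟪x, x⟫_ℝ ≠ 0 := by simpa using hx0
  -- `W = ℝ x ⊕ (x × Wᗮ)` by counting dimensions, `1 + 3 = 4`. For `y = c x + x × v` the double
  -- product then gives `x × y = -|x|² v`, which lies in `Wᗮ`.
  let T : (ℝ × Wᗮ) →ₗ[ℝ] W :=
    (LinearMap.toSpanSingleton ℝ W ⟨x, hx⟩).coprod
      (((crossL x).toLinearMap.comp Wᗮ.subtype).codRestrict W fun v => hvx v v.2)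
  have hT : ∀ q, (T q : R7) = q.1 • x + cross x q.2 := fun q => by
    simp [T, ← crossL_apply]
    rfl
  have hinj : Function.Injective T := by
    rw [← LinearMap.ker_eq_bot, LinearMap.ker_eq_bot']
    rintro ⟨c, v⟩ h
    have h0 : c • x + cross x v = 0 := by rw [← hT (c, v), h]; rfl
    have hc : c = 0 := by
      have := congrArg (fun t => ⟪t, x⟫_ℝ) h0
      simp only [inner_add_left, real_inner_smul_left, inner_cross_self_left, inner_zero_left,
        add_zero] at this
      exact (mul_eq_zero.1 this).resolve_right hxx
    rw [hc, zero_smul, zero_add] at h0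
    have h1 := cross_cross_self x v
    rw [h0, cross_zero_right, Submodule.inner_right_of_mem_orthogonal hx v.2, zero_smul, zero_sub,
      eq_comm, neg_eq_zero, smul_eq_zero] at h1
    ext1
    · exact hc
    · exact Subtype.ext (h1.resolve_left hxx)
  have hsurj : Function.Surjective T := by
    refine (LinearMap.injective_iff_surjective_of_finrank_eq_finrank ?_).1 hinj
    rw [Module.finrank_prod, hW.finrank_eq, hW.1]
    simp
  obtain ⟨⟨c, v⟩, hq⟩ := hsurj ⟨y, hy⟩
  have hy' : y = c • x + cross x v := by rw [← hT (c, v), hq]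
  rw [hy', cross_add_right, cross_smul_right, cross_self, smul_zero, zero_add, cross_cross_self,
    Submodule.inner_right_of_mem_orthogonal hx v.2, zero_smul, zero_sub]
  exact neg_mem (Submodule.smul_mem _ _ v.2)

/-! ### Directional derivatives of maps of a plane domain -/

section Calculus

variable {X Y Z : Type*} [NormedAddCommGroup X] [NormedSpace ℝ X] [NormedAddCommGroup Y]
  [NormedSpace ℝ Y] [NormedAddCommGroup Z] [NormedSpace ℝ Z] {U : Set ℂ} {z : ℂ}

/-- The derivative of `f` in the direction `v`. -/
def D (v : ℂ) (f : ℂ → X) (z : ℂ) : X := fderiv ℝ f z v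

theorem contDiffOn_D (hU : IsOpen U) {f : ℂ → X} (hf : ContDiffOn ℝ ∞ f U) (v : ℂ) :
    ContDiffOn ℝ ∞ (D v f) U :=
  (hf.fderiv_of_isOpen hU (by simp)).clm_apply contDiffOn_const

theorem _root_.ContDiffOn.differentiableAt_of_isOpen (hU : IsOpen U) {f : ℂ → X}
    (hf : ContDiffOn ℝ ∞ f U) (hz : z ∈ U) : DifferentiableAt ℝ f z :=
  (hf.contDiffAt (hU.mem_nhds hz)).differentiableAt (by simp)

theorem D_congr (hU : IsOpen U) {f g : ℂ → X} (h : Set.EqOn f g U) (hz : z ∈ U) (v : ℂ) :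
    D v f z = D v g z := by
  rw [D, D, (h.eventuallyEq_of_mem (hU.mem_nhds hz)).fderiv_eq]

theorem D_D_eq (hU : IsOpen U) {f : ℂ → X} (hf : ContDiffOn ℝ ∞ f U) (hz : z ∈ U) (u v : ℂ) :
    D u (D v f) z = fderiv ℝ (fderiv ℝ f) z u v := by
  have hd : DifferentiableAt ℝ (fderiv ℝ f) z :=
    ((hf.contDiffAt (hU.mem_nhds hz)).fderiv_right (m := ∞) (by simp)).differentiableAt (by simp)
  unfold D
  rw [fderiv_clm_apply hd (differentiableAt_const v)]
  simp

theorem D_comm (hU : IsOpen U) {f : ℂ → X} (hf : ContDiffOn ℝ ∞ f U) (hz : z ∈ U) (u v : ℂ) :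
    D u (D v f) z = D v (D u f) z := by
  have hs := (hf.contDiffAt (hU.mem_nhds hz)).isSymmSndFDerivAt
    (by simpa using WithTop.coe_le_coe.2 (le_top : (2 : ℕ∞) ≤ ⊤))
  rw [D_D_eq hU hf hz, D_D_eq hU hf hz, hs.eq]

theorem laplacian_eq_D (hU : IsOpen U) {f : ℂ → X} (hf : ContDiffOn ℝ ∞ f U) (hz : z ∈ U) :
    Laplacian.laplacian f z = D 1 (D 1 f) z + D Complex.I (D Complex.I f) z := by
  rw [InnerProductSpace.laplacian_eq_iteratedFDeriv_complexPlane, D_D_eq hU hf hz,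
    D_D_eq hU hf hz]
  simp [iteratedFDeriv_two_apply]

theorem D_neg_dir (f : ℂ → X) (z u : ℂ) : D (-u) f z = -D u f z := map_neg _ _

theorem D_eq (f : ℂ → X) (z v : ℂ) : D v f z = v.re • D 1 f z + v.im • D Complex.I f z := by
  unfold D
  rw [← map_smul, ← map_smul, ← map_add]
  congr 1
  simp

theorem D_bilin (B : X →L[ℝ] Y →L[ℝ] Z) {f : ℂ → X} {g : ℂ → Y} (hf : DifferentiableAt ℝ f z)
    (hg : DifferentiableAt ℝ g z) (v : ℂ) :
    D v (fun ζ => B (f ζ) (g ζ)) z = B (D v f z) (g z) + B (f z) (D v g z) := by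
  unfold D
  rw [B.fderiv_of_bilinear hf hg]
  simp [add_comm]

theorem D_cross {f g : ℂ → R7} (hf : DifferentiableAt ℝ f z) (hg : DifferentiableAt ℝ g z)
    (v : ℂ) : D v (fun ζ => cross (f ζ) (g ζ)) z =
      cross (D v f z) (g z) + cross (f z) (D v g z) :=
  D_bilin crossL hf hg v

theorem D_inner {f g : ℂ → R7} (hf : DifferentiableAt ℝ f z) (hg : DifferentiableAt ℝ g z)
    (v : ℂ) : D v (fun ζ => ⟪f ζ, g ζ⟫_ℝ) z = ⟪D v f z, g z⟫_ℝ + ⟪f z, D v g z⟫_ℝ :=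
  D_bilin (innerSL ℝ) hf hg v

theorem D_smul {c : ℂ → ℝ} {f : ℂ → X} (hc : DifferentiableAt ℝ c z)
    (hf : DifferentiableAt ℝ f z) (v : ℂ) :
    D v (fun ζ => c ζ • f ζ) z = D v c z • f z + c z • D v f z :=
  D_bilin (ContinuousLinearMap.lsmul ℝ ℝ) hc hf v

theorem D_mul {c d : ℂ → ℝ} (hc : DifferentiableAt ℝ c z) (hd : DifferentiableAt ℝ d z) (v : ℂ) :
    D v (fun ζ => c ζ * d ζ) z = D v c z * d z + c z * D v d z :=
  D_smul hc hd v

theorem D_add {f g : ℂ → X} (hf : DifferentiableAt ℝ f z) (hg : DifferentiableAt ℝ g z) (v : ℂ) :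
    D v (fun ζ => f ζ + g ζ) z = D v f z + D v g z := by
  unfold D; rw [fderiv_fun_add hf hg]; simp

theorem D_sub {f g : ℂ → X} (hf : DifferentiableAt ℝ f z) (hg : DifferentiableAt ℝ g z) (v : ℂ) :
    D v (fun ζ => f ζ - g ζ) z = D v f z - D v g z := by
  unfold D; rw [fderiv_fun_sub hf hg]; simp

theorem D_neg (f : ℂ → X) (v : ℂ) : D v (fun ζ => -f ζ) z = -D v f z := by
  unfold D; rw [fderiv_fun_neg]; simp

theorem D_const (c : X) (v : ℂ) : D v (fun _ => c) z = 0 := by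
  unfold D; simp

end Calculus

/-! ### The surface in a coordinate domain -/

/-- A conformal harmonic immersion `f` of a plane domain and a surface `g` associated to it. -/
structure IsLocalPair (U : Set ℂ) (f g : ℂ → R7) : Prop where
  isOpen : IsOpen U
  smooth : ContDiffOn ℝ ∞ f U
  smooth' : ContDiffOn ℝ ∞ g U
  unit : ∀ z ∈ U, ⟪f z, f z⟫_ℝ = 1
  immersed : ∀ z ∈ U, Function.Injective (fderiv ℝ f z)
  norm_eq : ∀ z ∈ U, ‖D 1 f z‖ = ‖D Complex.I f z‖
  inner_eq : ∀ z ∈ U, ⟪D 1 f z, D Complex.I f z⟫_ℝ = 0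
  harmonic : ∀ z ∈ U, ∀ u : R7, ⟪f z, u⟫_ℝ = 0 → ⟪Laplacian.laplacian f z, u⟫_ℝ = 0
  deriv_eq : ∀ z ∈ U, ∀ v : ℂ, D v g z = cross (f z) (D (Complex.I * v) f z)

/-- The conformal factor `|f_x|²`. -/
def energy (f : ℂ → R7) (z : ℂ) : ℝ := ⟪D 1 f z, D 1 f z⟫_ℝ

/-- The mean curvature vector of the surface associated to `f`. -/
def normalField (f : ℂ → R7) (z : ℂ) : R7 := (energy f z)⁻¹ • cross (D 1 f z) (D Complex.I f z)

/-- The real part of the coefficient of the Hopf differential of `g` in the direction of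
`normalField f`. -/
def hopfRe (f g : ℂ → R7) (z : ℂ) : ℝ := ⟪D 1 (D 1 g) z, normalField f z⟫_ℝ - energy f z

/-- Minus the imaginary part of the coefficient of the Hopf differential of `g` in the direction of
`normalField f`. -/
def hopfIm (f g : ℂ → R7) (z : ℂ) : ℝ := ⟪D 1 (D Complex.I g) z, normalField f z⟫_ℝ

/-- The derivative of `normalField f` is tangent to `g`. -/
def HasParallelNormalField (U : Set ℂ) (f g : ℂ → R7) : Prop :=
  ∀ z ∈ U, ∀ v, ∃ w, D w g z = D v (normalField f) z

namespace IsLocalPair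

variable {U : Set ℂ} {f g : ℂ → R7} {z : ℂ}

theorem diff (h : IsLocalPair U f g) (hz : z ∈ U) : DifferentiableAt ℝ f z :=
  h.smooth.differentiableAt_of_isOpen h.isOpen hz

theorem diff' (h : IsLocalPair U f g) (hz : z ∈ U) : DifferentiableAt ℝ g z :=
  h.smooth'.differentiableAt_of_isOpen h.isOpen hz

theorem smooth_D (h : IsLocalPair U f g) (v : ℂ) : ContDiffOn ℝ ∞ (D v f) U :=
  contDiffOn_D h.isOpen h.smooth v

theorem smooth_D' (h : IsLocalPair U f g) (v : ℂ) : ContDiffOn ℝ ∞ (D v g) U :=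
  contDiffOn_D h.isOpen h.smooth' v

theorem diff_D (h : IsLocalPair U f g) (hz : z ∈ U) (v : ℂ) : DifferentiableAt ℝ (D v f) z :=
  (h.smooth_D v).differentiableAt_of_isOpen h.isOpen hz

theorem diff_D' (h : IsLocalPair U f g) (hz : z ∈ U) (v : ℂ) : DifferentiableAt ℝ (D v g) z :=
  (h.smooth_D' v).differentiableAt_of_isOpen h.isOpen hz

theorem inner_D_self (h : IsLocalPair U f g) (hz : z ∈ U) (v : ℂ) : ⟪f z, D v f z⟫_ℝ = 0 := by
  have h1 := D_congr h.isOpen (f := fun ζ => ⟪f ζ, f ζ⟫_ℝ) (g := fun _ => 1) h.unit hz v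
  rw [D_inner (h.diff hz) (h.diff hz), D_const, real_inner_comm] at h1
  linarith

theorem frame (h : IsLocalPair U f g) (hz : z ∈ U) :
    ConformalFrame (f z) (D 1 f z) (D I f z) (energy f z) where
  pos := by
    refine real_inner_self_pos.2 fun h0 => ?_
    have := h.immersed z hz (h0.trans (map_zero _).symm)
    exact one_ne_zero this
  pp := h.unit z hz
  aa := rfl
  bb := by
    rw [energy, real_inner_self_eq_norm_sq, real_inner_self_eq_norm_sq, h.norm_eq z hz]
  ab := h.inner_eq z hz
  pa := h.inner_D_self hz 1
  pb := h.inner_D_self hz I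

theorem energy_ne (h : IsLocalPair U f g) (hz : z ∈ U) : energy f z ≠ 0 := (h.frame hz).pos.ne'

theorem inner_self_D_D (h : IsLocalPair U f g) (hz : z ∈ U) (u v : ℂ) :
    ⟪f z, D u (D v f) z⟫_ℝ = -⟪D u f z, D v f z⟫_ℝ := by
  have h1 := D_congr h.isOpen (f := fun ζ => ⟪f ζ, D v f ζ⟫_ℝ) (g := fun _ => 0)
    (fun ζ hζ => h.inner_D_self hζ v) hz u
  rw [D_inner (h.diff hz) (h.diff_D hz v), D_const] at h1
  linarith

/-- The harmonic map equation `Δf = -2E f`. The vector `Δf + 2E f` is orthogonal to `f`, so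
harmonicity makes it orthogonal to itself. This eliminates `f_yy` from all later formulas. -/
theorem D_I_D_I (h : IsLocalPair U f g) (hz : z ∈ U) :
    D I (D I f) z = -D 1 (D 1 f) z - (2 * energy f z) • f z := by
  have F := h.frame hz
  have h1 : ⟪f z, Laplacian.laplacian f z⟫_ℝ = -(2 * energy f z) := by
    rw [laplacian_eq_D h.isOpen h.smooth hz, inner_add_right, h.inner_self_D_D hz,
      h.inner_self_D_D hz, F.aa, F.bb]
    ring
  have h2 : Laplacian.laplacian f z + (2 * energy f z) • f z = 0 := by
    rw [← inner_self_eq_zero (𝕜 := ℝ)]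
    have h3 : ⟪f z, Laplacian.laplacian f z + (2 * energy f z) • f z⟫_ℝ = 0 := by
      rw [inner_add_right, h1, real_inner_smul_right, F.pp]; ring
    nth_rw 1 [inner_add_left]
    rw [h.harmonic z hz _ h3, real_inner_smul_left, h3]
    ring
  rw [laplacian_eq_D h.isOpen h.smooth hz] at h2
  linear_combination (norm := module) (1 : ℝ) • h2

theorem D_I_D_one (h : IsLocalPair U f g) (hz : z ∈ U) : D I (D 1 f) z = D 1 (D I f) z :=
  D_comm h.isOpen h.smooth hz _ _

theorem smooth_energy (h : IsLocalPair U f g) : ContDiffOn ℝ ∞ (energy f) U :=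
  (h.smooth_D 1).inner ℝ (h.smooth_D 1)

theorem smooth_normalField (h : IsLocalPair U f g) : ContDiffOn ℝ ∞ (normalField f) U := by
  refine (h.smooth_energy.inv fun z hz => h.energy_ne hz).smul ?_
  exact (crossL.contDiff.comp_contDiffOn (h.smooth_D 1)).clm_apply (h.smooth_D I)

theorem diff_normalField (h : IsLocalPair U f g) (hz : z ∈ U) :
    DifferentiableAt ℝ (normalField f) z :=
  h.smooth_normalField.differentiableAt_of_isOpen h.isOpen hz

theorem diff_energy (h : IsLocalPair U f g) (hz : z ∈ U) : DifferentiableAt ℝ (energy f) z :=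
  h.smooth_energy.differentiableAt_of_isOpen h.isOpen hz

theorem D_energy (h : IsLocalPair U f g) (hz : z ∈ U) (v : ℂ) :
    D v (energy f) z = 2 * ⟪D 1 f z, D v (D 1 f) z⟫_ℝ := by
  unfold energy
  rw [D_inner (h.diff_D hz 1) (h.diff_D hz 1), real_inner_comm]
  ring

theorem inner_I_D_one_I (h : IsLocalPair U f g) (hz : z ∈ U) :
    ⟪D I f z, D 1 (D I f) z⟫_ℝ = ⟪D 1 f z, D 1 (D 1 f) z⟫_ℝ := by
  have h1 := D_congr h.isOpen (f := fun ζ => ⟪D I f ζ, D I f ζ⟫_ℝ) (g := energy f)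
    (fun ζ hζ => (h.frame hζ).bb) hz 1
  rw [D_inner (h.diff_D hz I) (h.diff_D hz I), h.D_energy hz, real_inner_comm] at h1
  linarith

theorem inner_one_D_one_I (h : IsLocalPair U f g) (hz : z ∈ U) :
    ⟪D 1 f z, D 1 (D I f) z⟫_ℝ = -⟪D I f z, D 1 (D 1 f) z⟫_ℝ := by
  have h1 := D_congr h.isOpen (f := fun ζ => ⟪D 1 f ζ, D I f ζ⟫_ℝ) (g := fun _ => 0)
    h.inner_eq hz 1
  rw [D_inner (h.diff_D hz 1) (h.diff_D hz I), D_const, real_inner_comm] at h1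
  linarith

theorem D_one_g (h : IsLocalPair U f g) (hz : z ∈ U) : D 1 g z = cross (f z) (D I f z) := by
  rw [h.deriv_eq z hz, mul_one]

theorem D_I_g (h : IsLocalPair U f g) (hz : z ∈ U) : D I g z = -cross (f z) (D 1 f z) := by
  rw [h.deriv_eq z hz, Complex.I_mul_I, D_neg_dir, cross_neg_right]

theorem D_one_D_one_g (h : IsLocalPair U f g) (hz : z ∈ U) :
    D 1 (D 1 g) z = cross (D 1 f z) (D I f z) + cross (f z) (D 1 (D I f) z) := by
  rw [D_congr h.isOpen (fun ζ hζ => h.D_one_g hζ) hz, D_cross (h.diff hz) (h.diff_D hz I)]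

theorem D_one_D_I_g (h : IsLocalPair U f g) (hz : z ∈ U) :
    D 1 (D I g) z = -cross (f z) (D 1 (D 1 f) z) := by
  rw [D_congr h.isOpen (fun ζ hζ => h.D_I_g hζ) hz, D_neg, D_cross (h.diff hz) (h.diff_D hz 1),
    cross_self, zero_add]

theorem D_I_D_I_g (h : IsLocalPair U f g) (hz : z ∈ U) :
    D I (D I g) z = cross (D 1 f z) (D I f z) - cross (f z) (D 1 (D I f) z) := by
  rw [D_congr h.isOpen (fun ζ hζ => h.D_I_g hζ) hz, D_neg, D_cross (h.diff hz) (h.diff_D hz 1),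
    h.D_I_D_one hz, cross_comm (D I f z)]
  module

theorem smul_normalField (h : IsLocalPair U f g) (hz : z ∈ U) :
    energy f z • normalField f z = cross (D 1 f z) (D I f z) :=
  smul_inv_smul₀ (h.energy_ne hz) _

theorem inner_normalField_self (h : IsLocalPair U f g) (hz : z ∈ U) :
    ⟪normalField f z, normalField f z⟫_ℝ = 1 := by
  have := h.energy_ne hz
  rw [normalField, real_inner_smul_left, real_inner_smul_right, (h.frame hz).inner_ab_ab]
  field_simp

theorem inner_D_normalField_self (h : IsLocalPair U f g) (hz : z ∈ U) (v : ℂ) :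
    ⟪normalField f z, D v (normalField f) z⟫_ℝ = 0 := by
  have h1 := D_congr h.isOpen (f := fun ζ => ⟪normalField f ζ, normalField f ζ⟫_ℝ)
    (g := fun _ => 1) (fun ζ hζ => h.inner_normalField_self hζ) hz v
  rw [D_inner (h.diff_normalField hz) (h.diff_normalField hz), D_const, real_inner_comm] at h1
  linarith

theorem inner_D_g_normalField (h : IsLocalPair U f g) (hz : z ∈ U) (v : ℂ) :
    ⟪D v g z, normalField f z⟫_ℝ = 0 := by
  rw [D_eq, h.D_one_g hz, h.D_I_g hz, normalField, real_inner_smul_right, inner_add_left,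
    real_inner_smul_left, real_inner_smul_left, inner_neg_left, (h.frame hz).inner_pb_ab,
    (h.frame hz).inner_pa_ab]
  ring

theorem inner_D_normalField (h : IsLocalPair U f g) (hz : z ∈ U) (u v : ℂ) :
    ⟪D v g z, D u (normalField f) z⟫_ℝ = -⟪D u (D v g) z, normalField f z⟫_ℝ := by
  have h1 := D_congr h.isOpen (f := fun ζ => ⟪D v g ζ, normalField f ζ⟫_ℝ)
    (g := fun _ => 0) (fun ζ hζ => h.inner_D_g_normalField hζ v) hz u
  rw [D_inner (h.diff_D' hz v) (h.diff_normalField hz), D_const] at h1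
  linarith

/-! ### First fundamental form and mean curvature vector of `g`. -/

theorem inner_g_one_one (h : IsLocalPair U f g) (hz : z ∈ U) :
    ⟪D 1 g z, D 1 g z⟫_ℝ = energy f z := by
  rw [h.D_one_g hz, (h.frame hz).inner_pb_pb]

theorem inner_g_I_I (h : IsLocalPair U f g) (hz : z ∈ U) :
    ⟪D I g z, D I g z⟫_ℝ = energy f z := by
  rw [h.D_I_g hz, inner_neg_neg, (h.frame hz).inner_pa_pa]

theorem inner_g_one_I (h : IsLocalPair U f g) (hz : z ∈ U) : ⟪D 1 g z, D I g z⟫_ℝ = 0 := by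
  rw [h.D_one_g hz, h.D_I_g hz, inner_neg_right, real_inner_comm, (h.frame hz).inner_pa_pb,
    neg_zero]

theorem D_D_g_add (h : IsLocalPair U f g) (hz : z ∈ U) :
    D 1 (D 1 g) z + D I (D I g) z = (2 * energy f z) • normalField f z := by
  rw [h.D_one_D_one_g hz, h.D_I_D_I_g hz, mul_smul, h.smul_normalField hz]
  module

theorem injective_fderiv_g (h : IsLocalPair U f g) (hz : z ∈ U) :
    Function.Injective (fderiv ℝ g z) := by
  rw [injective_iff_map_eq_zero]
  intro v hv
  have hv' : D v g z = 0 := hv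
  rw [D_eq] at hv'
  have h1 := congrArg (fun x => ⟪D 1 g z, x⟫_ℝ) hv'
  have h2 := congrArg (fun x => ⟪D I g z, x⟫_ℝ) hv'
  simp only [inner_add_right, real_inner_smul_right, h.inner_g_one_one hz, h.inner_g_one_I hz,
    h.inner_g_I_I hz, real_inner_comm (D 1 g z) (D I g z), inner_zero_right] at h1 h2
  have hE := h.energy_ne hz
  apply Complex.ext
  · simpa [hE] using h1
  · simpa [hE] using h2

theorem normalProj_eq_self {g : ℂ → R7} {z : ℂ} {x : R7} (hx : ∀ v, ⟪D v g z, x⟫_ℝ = 0) :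
    normalProj g z x = x := by
  rw [normalProj, Submodule.starProjection_eq_self_iff, Submodule.mem_orthogonal]
  rintro _ ⟨v, rfl⟩
  exact hx v

theorem normalProj_eq_zero_iff {g : ℂ → R7} {z : ℂ} {x : R7} :
    normalProj g z x = 0 ↔ ∃ v, D v g z = x := by
  rw [normalProj, Submodule.starProjection_apply_eq_zero_iff, Submodule.orthogonal_orthogonal]
  rfl

theorem inner_normalProj {g : ℂ → R7} {z : ℂ} {x : R7} (hx : ∀ v, ⟪D v g z, x⟫_ℝ = 0) (y : R7) :
    ⟪normalProj g z y, x⟫_ℝ = ⟪y, x⟫_ℝ := by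
  rw [normalProj, Submodule.inner_starProjection_left_eq_right, ← normalProj,
    normalProj_eq_self hx]

/-- In a conformal coordinate the mean curvature vector is the normal part of `Δg / (2E)`, and `Δg =
2E N` is already normal. -/
theorem meanCurv_eq (h : IsLocalPair U f g) (hz : z ∈ U) : meanCurv g z = normalField f z := by
  have hE := h.energy_ne hz
  have e1 : firstFF g z 1 1 = energy f z := h.inner_g_one_one hz
  have e2 : firstFF g z I I = energy f z := h.inner_g_I_I hz
  have e3 : firstFF g z 1 I = 0 := h.inner_g_one_I hz
  have e4 : secondFF g z 1 1 + secondFF g z I I = (2 * energy f z) • normalField f z := by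
    have : secondFF g z 1 1 + secondFF g z I I =
        normalProj g z (D 1 (D 1 g) z + D I (D I g) z) := (map_add _ _ _).symm
    rw [this, h.D_D_g_add hz, map_smul, normalProj_eq_self (h.inner_D_g_normalField hz)]
  have e5 : energy f z • secondFF g z 1 1 - (0 : ℝ) • secondFF g z 1 I +
      energy f z • secondFF g z I I = energy f z • (2 * energy f z) • normalField f z := by
    rw [← e4]; module
  rw [meanCurv, e1, e2, e3, mul_zero, e5, smul_smul, smul_smul]
  convert one_smul ℝ _
  field_simp
  ring

theorem D_meanCurv (h : IsLocalPair U f g) (hz : z ∈ U) (v : ℂ) :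
    fderiv ℝ (meanCurv g) z v = D v (normalField f) z :=
  D_congr h.isOpen (fun _ hζ => h.meanCurv_eq hζ) hz v

/-! ### The Hopf coefficients and the shape operator of `N`. -/

theorem smooth_hopfRe (h : IsLocalPair U f g) : ContDiffOn ℝ ∞ (hopfRe f g) U :=
  ((contDiffOn_D h.isOpen (h.smooth_D' 1) 1).inner ℝ h.smooth_normalField).sub h.smooth_energy

theorem smooth_hopfIm (h : IsLocalPair U f g) : ContDiffOn ℝ ∞ (hopfIm f g) U :=
  (contDiffOn_D h.isOpen (h.smooth_D' I) 1).inner ℝ h.smooth_normalField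

theorem diff_D_D' (h : IsLocalPair U f g) (hz : z ∈ U) (u v : ℂ) :
    DifferentiableAt ℝ (D u (D v g)) z :=
  (contDiffOn_D h.isOpen (h.smooth_D' v) u).differentiableAt_of_isOpen h.isOpen hz

theorem inner_D_I_D_I_g (h : IsLocalPair U f g) (hz : z ∈ U) :
    ⟪D I (D I g) z, normalField f z⟫_ℝ = energy f z - hopfRe f g z := by
  have := congrArg (fun x => ⟪x, normalField f z⟫_ℝ) (h.D_D_g_add hz)
  simp only [inner_add_left, real_inner_smul_left, h.inner_normalField_self hz] at this
  rw [hopfRe]; linarith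

theorem inner_one_D_normalField_one (h : IsLocalPair U f g) (hz : z ∈ U) :
    ⟪D 1 g z, D 1 (normalField f) z⟫_ℝ = -(energy f z + hopfRe f g z) := by
  rw [h.inner_D_normalField hz, hopfRe]; ring

theorem inner_I_D_normalField_one (h : IsLocalPair U f g) (hz : z ∈ U) :
    ⟪D I g z, D 1 (normalField f) z⟫_ℝ = -hopfIm f g z := by
  rw [h.inner_D_normalField hz, hopfIm]

theorem inner_one_D_normalField_I (h : IsLocalPair U f g) (hz : z ∈ U) :
    ⟪D 1 g z, D I (normalField f) z⟫_ℝ = -hopfIm f g z := by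
  rw [h.inner_D_normalField hz, hopfIm, D_comm h.isOpen h.smooth' hz]

theorem inner_I_D_normalField_I (h : IsLocalPair U f g) (hz : z ∈ U) :
    ⟪D I g z, D I (normalField f) z⟫_ℝ = -(energy f z - hopfRe f g z) := by
  rw [h.inner_D_normalField hz, h.inner_D_I_D_I_g hz]

theorem hopf_eq_zero_of_D_eq (h : IsLocalPair U f g) (hz : z ∈ U)
    (h1 : ∀ v, D v (normalField f) z = -D v g z) : hopfRe f g z = 0 ∧ hopfIm f g z = 0 := by
  have e1 := h.inner_one_D_normalField_one hz
  have e2 := h.inner_I_D_normalField_one hz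
  rw [h1, inner_neg_right, h.inner_g_one_one hz] at e1
  rw [h1, inner_neg_right, real_inner_comm, h.inner_g_one_I hz] at e2
  constructor <;> linarith

/-! ### Parallel mean curvature vector -/

theorem D_normalField_eq (h : IsLocalPair U f g) (hP : HasParallelNormalField U f g) (hz : z ∈ U)
    (v : ℂ) : D v (normalField f) z =
      (⟪D 1 g z, D v (normalField f) z⟫_ℝ / energy f z) • D 1 g z +
      (⟪D I g z, D v (normalField f) z⟫_ℝ / energy f z) • D I g z := by
  obtain ⟨w, hw⟩ := hP z hz v
  have hE := h.energy_ne hz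
  rw [← hw, D_eq, inner_add_right, inner_add_right]
  simp only [real_inner_smul_right, h.inner_g_one_one hz, h.inner_g_one_I hz,
    h.inner_g_I_I hz, real_inner_comm (D 1 g z) (D I g z)]
  congr 2 <;> field_simp <;> ring

theorem D_one_normalField (h : IsLocalPair U f g) (hP : HasParallelNormalField U f g)
    (hz : z ∈ U) : D 1 (normalField f) z =
      -((energy f z + hopfRe f g z) / energy f z) • D 1 g z
      - (hopfIm f g z / energy f z) • D I g z := by
  rw [h.D_normalField_eq hP hz, h.inner_one_D_normalField_one hz, h.inner_I_D_normalField_one hz]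
  module

theorem D_I_normalField (h : IsLocalPair U f g) (hP : HasParallelNormalField U f g)
    (hz : z ∈ U) : D I (normalField f) z = -(hopfIm f g z / energy f z) • D 1 g z
      - ((energy f z - hopfRe f g z) / energy f z) • D I g z := by
  rw [h.D_normalField_eq hP hz, h.inner_one_D_normalField_I hz, h.inner_I_D_normalField_I hz]
  module

theorem D_eq_of_hopf_eq_zero (h : IsLocalPair U f g) (hP : HasParallelNormalField U f g)
    (hz : z ∈ U) (h1 : hopfRe f g z = 0) (h2 : hopfIm f g z = 0) (v : ℂ) :
    D v (normalField f) z = -D v g z := by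
  have hE := h.energy_ne hz
  rw [D_eq _ z v, h.D_one_normalField hP hz, h.D_I_normalField hP hz, h1, h2, D_eq g z v]
  simp only [add_zero, sub_zero, zero_div, div_self hE]
  module

theorem inner_D_D_g (h : IsLocalPair U f g) (hz : z ∈ U) :
    ⟪D 1 (D 1 g) z, D 1 g z⟫_ℝ = D 1 (energy f) z / 2 ∧
    ⟪D 1 (D 1 g) z, D I g z⟫_ℝ = -D I (energy f) z / 2 ∧
    ⟪D 1 (D I g) z, D 1 g z⟫_ℝ = D I (energy f) z / 2 ∧
    ⟪D 1 (D I g) z, D I g z⟫_ℝ = D 1 (energy f) z / 2 ∧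
    ⟪D I (D I g) z, D 1 g z⟫_ℝ = -D 1 (energy f) z / 2 ∧
    ⟪D I (D I g) z, D I g z⟫_ℝ = D I (energy f) z / 2 := by
  have c1 := fun v => D_congr h.isOpen (f := fun ζ => ⟪D 1 g ζ, D 1 g ζ⟫_ℝ) (g := energy f)
    (fun ζ hζ => h.inner_g_one_one hζ) hz v
  have c2 := fun v => D_congr h.isOpen (f := fun ζ => ⟪D I g ζ, D I g ζ⟫_ℝ) (g := energy f)
    (fun ζ hζ => h.inner_g_I_I hζ) hz v
  have c3 := fun v => D_congr h.isOpen (f := fun ζ => ⟪D 1 g ζ, D I g ζ⟫_ℝ) (g := fun _ => 0)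
    (fun ζ hζ => h.inner_g_one_I hζ) hz v
  simp only [D_inner (h.diff_D' hz _) (h.diff_D' hz _), D_const] at c1 c2 c3
  have c11 := c1 1
  have c1I := c1 I
  have c21 := c2 1
  have c2I := c2 I
  have c31 := c3 1
  have c3I := c3 I
  rw [D_comm h.isOpen h.smooth' hz I 1] at c1I c3I
  simp only [real_inner_comm _ (D 1 g z), real_inner_comm _ (D I g z)] at *
  refine ⟨?_, ?_, ?_, ?_, ?_, ?_⟩ <;> linarith

/-- One of the two Codazzi equations. The third derivatives of `g` agree, and since the derivatives
of `N` are tangent, only derivatives of `E` enter the remaining terms. -/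
theorem D_I_hopfRe (h : IsLocalPair U f g) (hP : HasParallelNormalField U f g) (hz : z ∈ U) :
    D I (hopfRe f g) z = D 1 (hopfIm f g) z := by
  have hE := h.energy_ne hz
  have e3 : D I (D 1 (D 1 g)) z = D 1 (D 1 (D I g)) z := by
    rw [D_comm h.isOpen (h.smooth_D' 1) hz]
    exact D_congr h.isOpen (fun ζ hζ => D_comm h.isOpen h.smooth' hζ _ _) hz _
  obtain ⟨i1, i2, i3, i4, -, -⟩ := h.inner_D_D_g hz
  unfold hopfRe hopfIm
  rw [D_sub ((h.diff_D_D' hz 1 1).inner ℝ (h.diff_normalField hz)) (h.diff_energy hz),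
    D_inner (h.diff_D_D' hz 1 1) (h.diff_normalField hz),
    D_inner (h.diff_D_D' hz 1 I) (h.diff_normalField hz), e3, h.D_one_normalField hP hz,
    h.D_I_normalField hP hz]
  simp only [inner_sub_right, real_inner_smul_right, i1, i2, i3, i4]
  field_simp
  ring

theorem D_one_hopfRe (h : IsLocalPair U f g) (hP : HasParallelNormalField U f g) (hz : z ∈ U) :
    D 1 (hopfRe f g) z = -D I (hopfIm f g) z := by
  have hE := h.energy_ne hz
  obtain ⟨-, -, i3, i4, i5, i6⟩ := h.inner_D_D_g hz
  -- Expressing `P` through `g_yy` makes the third derivative `g_xyy`, the same as on the other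
  -- side.
  have e : Set.EqOn (hopfRe f g) (fun ζ => energy f ζ - ⟪D I (D I g) ζ, normalField f ζ⟫_ℝ) U :=
    fun ζ hζ => by simp only [h.inner_D_I_D_I_g hζ]; ring
  rw [D_congr h.isOpen e hz]
  unfold hopfIm
  rw [D_sub (h.diff_energy hz) ((h.diff_D_D' hz I I).inner ℝ (h.diff_normalField hz)),
    D_inner (h.diff_D_D' hz I I) (h.diff_normalField hz),
    D_inner (h.diff_D_D' hz 1 I) (h.diff_normalField hz), D_comm h.isOpen (h.smooth_D' I) hz I 1,
    h.D_one_normalField hP hz, h.D_I_normalField hP hz]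
  simp only [inner_sub_right, real_inner_smul_right, i3, i4, i5, i6]
  field_simp
  ring

/-- The Hopf differential in the direction of a parallel mean curvature vector is holomorphic. -/
theorem differentiableOn_hopf (h : IsLocalPair U f g) (hP : HasParallelNormalField U f g) :
    DifferentiableOn ℂ (fun ζ => (hopfRe f g ζ : ℂ) - (hopfIm f g ζ : ℂ) * I) U := by
  intro z hz
  refine DifferentiableAt.differentiableWithinAt ?_
  have d1 := h.smooth_hopfRe.differentiableAt_of_isOpen h.isOpen hz
  have d2 := h.smooth_hopfIm.differentiableAt_of_isOpen h.isOpen hz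
  have hd : HasFDerivAt (fun ζ => (hopfRe f g ζ : ℂ) - (hopfIm f g ζ : ℂ) * I)
      (Complex.ofRealCLM.comp (fderiv ℝ (hopfRe f g) z)
        - (Complex.ofRealCLM.comp (fderiv ℝ (hopfIm f g) z)).smulRight I) z := by
    refine HasFDerivAt.sub (Complex.ofRealCLM.hasFDerivAt.comp z d1.hasFDerivAt) ?_
    exact (Complex.ofRealCLM.hasFDerivAt.comp z d2.hasFDerivAt).mul_const' I
  rw [differentiableAt_complex_iff_differentiableAt_real]
  refine ⟨hd.differentiableAt, ?_⟩
  rw [hd.fderiv]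
  have c1 := h.D_I_hopfRe hP hz
  have c2 := h.D_one_hopfRe hP hz
  unfold D at c1 c2
  simp [c1, c2]
  linear_combination ((fderiv ℝ (hopfIm f g) z 1 : ℂ)) * Complex.I_mul_I

/-- The Ricci equation: the normal part of `N_xy = N_yx`. With the shape operator inserted it reads
`2P g_xy = R (g_xx - g_yy)` modulo tangent vectors, where `g_xy = -f × f_xx` and `g_xx - g_yy = 2 f
× f_xy`. -/
theorem inner_cross_eq_zero (h : IsLocalPair U f g) (hP : HasParallelNormalField U f g)
    (hz : z ∈ U) {u : R7} (h1 : ⟪D 1 g z, u⟫_ℝ = 0) (h2 : ⟪D I g z, u⟫_ℝ = 0) :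
    ⟪cross (f z) (hopfRe f g z • D 1 (D 1 f) z + hopfIm f g z • D 1 (D I f) z), u⟫_ℝ = 0 := by
  have hE := h.energy_ne hz
  have dN : ∀ v, DifferentiableAt ℝ (D v (normalField f)) z := fun v =>
    (contDiffOn_D h.isOpen h.smooth_normalField v).differentiableAt_of_isOpen h.isOpen hz
  -- Derivatives of the coefficients drop out, being multiplied by tangent vectors.
  have key : ∀ v w, ⟪D w (D v (normalField f)) z, u⟫_ℝ =
      (⟪D 1 g z, D v (normalField f) z⟫_ℝ / energy f z) * ⟪D w (D 1 g) z, u⟫_ℝ +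
      (⟪D I g z, D v (normalField f) z⟫_ℝ / energy f z) * ⟪D w (D I g) z, u⟫_ℝ := by
    intro v w
    have d1 : DifferentiableAt ℝ
        (fun ζ => ⟪D 1 g ζ, D v (normalField f) ζ⟫_ℝ / energy f ζ) z :=
      ((h.diff_D' hz 1).inner ℝ (dN v)).mul ((h.diff_energy hz).inv hE)
    have d2 : DifferentiableAt ℝ
        (fun ζ => ⟪D I g ζ, D v (normalField f) ζ⟫_ℝ / energy f ζ) z :=
      ((h.diff_D' hz I).inner ℝ (dN v)).mul ((h.diff_energy hz).inv hE)
    rw [D_congr h.isOpen (fun ζ hζ => h.D_normalField_eq hP hζ v) hz w,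
      D_add (d1.fun_smul (h.diff_D' hz 1)) (d2.fun_smul (h.diff_D' hz I)), D_smul d1 (h.diff_D' hz 1),
      D_smul d2 (h.diff_D' hz I)]
    simp only [inner_add_left, real_inner_smul_left, h1, h2]
    ring
  have e := congrArg (fun x => ⟪x, u⟫_ℝ) (D_comm h.isOpen h.smooth_normalField hz I 1)
  simp only [key, h.inner_one_D_normalField_one hz, h.inner_I_D_normalField_one hz,
    h.inner_one_D_normalField_I hz, h.inner_I_D_normalField_I hz,
    D_comm h.isOpen h.smooth' hz I 1] at e
  rw [h.D_one_D_one_g hz, h.D_one_D_I_g hz, h.D_I_D_I_g hz] at e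
  simp only [inner_add_left, inner_sub_left, inner_neg_left] at e
  rw [cross_add_right, cross_smul_right, cross_smul_right, inner_add_left, real_inner_smul_left,
    real_inner_smul_left]
  field_simp at e
  linarith

/-- The structure equations at a point that is not umbilical with respect to a parallel mean
curvature vector. -/
theorem structure_eq (h : IsLocalPair U f g) (hP : HasParallelNormalField U f g) (hz : z ∈ U)
    (hPR : hopfRe f g z ^ 2 + hopfIm f g z ^ 2 ≠ 0) :
    ⟪f z, normalField f z⟫_ℝ = 0 ∧
    D 1 (D 1 f) z = -energy f z • f z + (⟪D 1 f z, D 1 (D 1 f) z⟫_ℝ / energy f z) • D 1 f z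
      + (⟪D I f z, D 1 (D 1 f) z⟫_ℝ / energy f z) • D I f z
      - hopfIm f g z • cross (normalField f z) (f z) ∧
    D 1 (D I f) z = -(⟪D I f z, D 1 (D 1 f) z⟫_ℝ / energy f z) • D 1 f z
      + (⟪D 1 f z, D 1 (D 1 f) z⟫_ℝ / energy f z) • D I f z
      + hopfRe f g z • cross (normalField f z) (f z) := by
  have hE := h.energy_ne hz
  -- Both directional derivatives of `E N = f_x × f_y` supply the hypotheses `H1` and `H2` of
  -- `eq_of_not_umbilic`; the Ricci equation supplies `H3`.
  have e := fun v => D_congr h.isOpen (fun ζ hζ => h.smul_normalField hζ) hz v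
  simp only [D_smul (h.diff_energy hz) (h.diff_normalField hz),
    D_cross (h.diff_D hz 1) (h.diff_D hz I)] at e
  have hN : normalField f z = (1 / energy f z) • cross (D 1 f z) (D I f z) := by
    rw [one_div]; rfl
  have H1 := e 1
  have H2 := e I
  rw [h.D_one_normalField hP hz, h.D_energy hz, h.D_one_g hz, h.D_I_g hz, hN] at H1
  rw [h.D_I_normalField hP hz, h.D_energy hz, h.D_one_g hz, h.D_I_g hz, h.D_I_D_I hz,
    h.D_I_D_one hz, hN] at H2
  have key := (h.frame hz).eq_of_not_umbilic (α := D 1 (D 1 f) z) (β := D 1 (D I f) z)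
    (P := hopfRe f g z) (R := hopfIm f g z)
    (h.inner_self_D_D hz 1 1) (by rw [h.inner_self_D_D hz, h.inner_eq z hz, neg_zero])
    (h.inner_I_D_one_I hz) (h.inner_one_D_one_I hz)
    (by rw [← H1]; match_scalars <;> field_simp)
    (by rw [← H2]; match_scalars <;> field_simp)
    (fun u h1 h2 => h.inner_cross_eq_zero hP hz (by rw [h.D_one_g hz, h2])
      (by rw [h.D_I_g hz, inner_neg_left, h1, neg_zero])) hPR
  obtain ⟨k1, k2, k3⟩ := key
  rw [h.inner_one_D_one_I hz, h.inner_I_D_one_I hz] at k3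
  refine ⟨?_, ?_, ?_⟩
  · rw [hN, real_inner_smul_right, k1, mul_zero]
  · nth_rw 1 [k2]
    rw [hN, cross_smul_left]
    module
  · nth_rw 1 [k3]
    rw [hN, cross_smul_left]
    module

end IsLocalPair

/-! ### Maps into a fixed subspace. -/

theorem D_mem {U : Set ℂ} (hU : IsOpen U) {f : ℂ → R7} (hf : ContDiffOn ℝ ∞ f U)
    {W : Submodule ℝ R7} (hW : ∀ z ∈ U, f z ∈ W) {z : ℂ} (hz : z ∈ U) (v : ℂ) : D v f z ∈ W := by
  rw [← Submodule.orthogonal_orthogonal W]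
  intro u hu
  have h := D_congr hU (f := fun ζ => ⟪u, f ζ⟫_ℝ) (g := fun _ => 0)
    (fun ζ hζ => Submodule.inner_left_of_mem_orthogonal (hW ζ hζ) hu) hz v
  rwa [D_inner (differentiableAt_const u) (hf.differentiableAt_of_isOpen hU hz), D_const, D_const,
    inner_zero_left, zero_add] at h

/-- A vector of a coassociative plane `W` containing `p`, `a`, `b` is a combination of these if its
component normal to them vanishes. -/
theorem ConformalFrame.eq_combination {p a b : R7} {E : ℝ} (F : ConformalFrame p a b E)
    {W : Submodule ℝ R7} (hW : IsCoassociative W) (hp : p ∈ W) (ha : a ∈ W) (hb : b ∈ W) {w : R7}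
    (hw : w ∈ W) (h0 : ⟪cross p w, cross a b⟫_ℝ = 0) :
    w = ⟪p, w⟫_ℝ • p + (⟪a, w⟫_ℝ / E) • a + (⟪b, w⟫_ℝ / E) • b := by
  have hE := F.pos.ne'
  obtain ⟨x, hx⟩ : ∃ x, x = w - (⟪p, w⟫_ℝ • p + (⟪a, w⟫_ℝ / E) • a + (⟪b, w⟫_ℝ / E) • b) := ⟨_, rfl⟩
  have hxW : x ∈ W := by
    rw [hx]
    exact sub_mem hw (add_mem (add_mem (W.smul_mem _ hp) (W.smul_mem _ ha)) (W.smul_mem _ hb))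
  have ba : ⟪b, a⟫_ℝ = 0 := by rw [real_inner_comm, F.ab]
  have ap : ⟪a, p⟫_ℝ = 0 := by rw [real_inner_comm, F.pa]
  have bp : ⟪b, p⟫_ℝ = 0 := by rw [real_inner_comm, F.pb]
  have px : ⟪p, x⟫_ℝ = 0 := by
    simp only [hx, inner_sub_right, inner_add_right, real_inner_smul_right, F.pp, F.pa, F.pb]
    ring
  have ax : ⟪a, x⟫_ℝ = 0 := by
    simp only [hx, inner_sub_right, inner_add_right, real_inner_smul_right, F.aa, F.ab, ap]
    field_simp; ring
  have bx : ⟪b, x⟫_ℝ = 0 := by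
    simp only [hx, inner_sub_right, inner_add_right, real_inner_smul_right, F.bb, ba, bp]
    field_simp; ring
  have h1 : ⟪cross a b, cross p x⟫_ℝ = 0 := by
    rw [real_inner_comm, hx]
    simp only [cross_sub_right, cross_add_right, cross_smul_right, cross_self, inner_sub_left,
      inner_add_left, real_inner_smul_left, h0, F.inner_pa_ab, F.inner_pb_ab, inner_zero_left]
    ring
  -- `x` is the part of `w` orthogonal to `p`, `a`, `b`. The product `p × x` lies in the three-space
  -- `Wᗮ` and is orthogonal to its frame; it determines `x` because `p × (p × x) = -x`.
  have h2 : cross p x = 0 := by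
    refine F.eq_zero_of_mem hW.1 (hW.cross_mem hp ha) (hW.cross_mem hp hb) (hW.cross_mem ha hb)
      (hW.cross_mem hp hxW) ?_ ?_ h1
    · rw [inner_cross_cross, ax, F.pa]; ring
    · rw [inner_cross_cross, bx, F.pb]; ring
  have h3 := F.cross_cross x
  rw [h2, cross_zero_right, px, zero_smul, zero_sub, eq_comm, neg_eq_zero, hx, sub_eq_zero] at h3
  exact h3

/-! ### Propagation of umbilicity, and constancy of the span of `g_x`, `g_y`, `N`. -/

/-- The squared length of the projection of `u` to the span of `g_x`, `g_y` and the mean curvature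
vector. -/
def projSq (f g : ℂ → R7) (u : R7) (z : ℂ) : ℝ :=
  (energy f z)⁻¹ * (⟪D 1 g z, u⟫_ℝ * ⟪D 1 g z, u⟫_ℝ + ⟪D Complex.I g z, u⟫_ℝ * ⟪D Complex.I g z, u⟫_ℝ)
    + ⟪normalField f z, u⟫_ℝ * ⟪normalField f z, u⟫_ℝ

namespace IsLocalPair

variable {U : Set ℂ} {f g : ℂ → R7} {z : ℂ}

theorem hopf_eq_zero (h : IsLocalPair U f g) (hP : HasParallelNormalField U f g)
    (hU : IsPreconnected U) (hz : z ∈ U)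
    (h0 : ∀ᶠ ζ in 𝓝 z, hopfRe f g ζ = 0 ∧ hopfIm f g ζ = 0) {w : ℂ} (hw : w ∈ U) :
    hopfRe f g w = 0 ∧ hopfIm f g w = 0 := by
  have ha := (h.differentiableOn_hopf hP).analyticOnNhd h.isOpen
  have := ha.eqOn_zero_of_preconnected_of_eventuallyEq_zero hU hz
    (h0.mono fun ζ hζ => by simp [hζ.1, hζ.2]) hw
  constructor
  · simpa using congrArg Complex.re this
  · simpa using congrArg Complex.im this

theorem smooth_projSq (h : IsLocalPair U f g) (u : R7) : ContDiffOn ℝ ∞ (projSq f g u) U := by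
  have h1 : ∀ v, ContDiffOn ℝ ∞ (fun ζ => ⟪D v g ζ, u⟫_ℝ) U := fun v =>
    (h.smooth_D' v).inner ℝ contDiffOn_const
  have h2 : ContDiffOn ℝ ∞ (fun ζ => ⟪normalField f ζ, u⟫_ℝ) U :=
    h.smooth_normalField.inner ℝ contDiffOn_const
  exact ((h.smooth_energy.inv fun z hz => h.energy_ne hz).mul
    (((h1 1).mul (h1 1)).add ((h1 I).mul (h1 I)))).add (h2.mul h2)

theorem D_inv_energy (h : IsLocalPair U f g) (hz : z ∈ U) (v : ℂ) :
    D v (fun ζ => (energy f ζ)⁻¹) z = -D v (energy f) z / energy f z ^ 2 := by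
  have hE := h.energy_ne hz
  have h1 := D_congr h.isOpen (f := fun ζ => energy f ζ * (energy f ζ)⁻¹) (g := fun _ => 1)
    (fun ζ hζ => mul_inv_cancel₀ (h.energy_ne hζ)) hz v
  have d3 : DifferentiableAt ℝ (fun ζ => (energy f ζ)⁻¹) z := (h.diff_energy hz).inv hE
  rw [D_mul (h.diff_energy hz) d3, D_const] at h1
  field_simp
  field_simp at h1
  linarith

theorem D_projSq (h : IsLocalPair U f g) (hz : z ∈ U) (u : R7) (v : ℂ) :
    D v (projSq f g u) z =
      -D v (energy f) z / energy f z ^ 2 * (⟪D 1 g z, u⟫_ℝ ^ 2 + ⟪D I g z, u⟫_ℝ ^ 2)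
      + 2 * (energy f z)⁻¹ * (⟪D 1 g z, u⟫_ℝ * ⟪D v (D 1 g) z, u⟫_ℝ
        + ⟪D I g z, u⟫_ℝ * ⟪D v (D I g) z, u⟫_ℝ)
      + 2 * ⟪normalField f z, u⟫_ℝ * ⟪D v (normalField f) z, u⟫_ℝ := by
  have hE := h.energy_ne hz
  have d1 : ∀ w, DifferentiableAt ℝ (fun ζ => ⟪D w g ζ, u⟫_ℝ) z := fun w =>
    (h.diff_D' hz w).inner ℝ (differentiableAt_const u)
  have d2 : DifferentiableAt ℝ (fun ζ => ⟪normalField f ζ, u⟫_ℝ) z :=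
    (h.diff_normalField hz).inner ℝ (differentiableAt_const u)
  have d3 : DifferentiableAt ℝ (fun ζ => (energy f ζ)⁻¹) z := (h.diff_energy hz).inv hE
  unfold projSq
  rw [D_add (d3.fun_mul (((d1 1).fun_mul (d1 1)).fun_add ((d1 I).fun_mul (d1 I)))) (d2.fun_mul d2),
    D_mul d3 (((d1 1).fun_mul (d1 1)).fun_add ((d1 I).fun_mul (d1 I))),
    D_add ((d1 1).fun_mul (d1 1)) ((d1 I).fun_mul (d1 I)), D_mul (d1 1) (d1 1),
    D_mul (d1 I) (d1 I), D_mul d2 d2, D_inner (h.diff_D' hz 1) (differentiableAt_const u),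
    D_inner (h.diff_D' hz I) (differentiableAt_const u),
    D_inner (h.diff_normalField hz) (differentiableAt_const u), D_const, h.D_inv_energy hz]
  simp only [inner_zero_right]
  ring

/-- At a point that is not umbilical with respect to the parallel mean curvature vector, the
derivatives of `g_x`, `g_y` and the mean curvature vector lie in their span. -/
theorem D_projSq_eq_zero (h : IsLocalPair U f g) (hP : HasParallelNormalField U f g) (hz : z ∈ U)
    (hPR : hopfRe f g z ^ 2 + hopfIm f g z ^ 2 ≠ 0) (u : R7) (v : ℂ) :
    D v (projSq f g u) z = 0 := by
  obtain ⟨k1, k2, k3⟩ := h.structure_eq hP hz hPR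
  have hE := h.energy_ne hz
  -- This uses `f ⟂ N`. It turns the component of `f_xx` and `f_xy` along `N × f` into a multiple of
  -- `N` in the second derivatives of `g`, so no direction outside the span appears.
  have cN : cross (f z) (cross (normalField f z) (f z)) = normalField f z := by
    rw [cross_comm (normalField f z), cross_neg_right, (h.frame hz).cross_cross, k1]
    module
  have g11 : D 1 (D 1 g) z = (energy f z + hopfRe f g z) • normalField f z
      + (⟪D 1 f z, D 1 (D 1 f) z⟫_ℝ / energy f z) • D 1 g z
      + (⟪D I f z, D 1 (D 1 f) z⟫_ℝ / energy f z) • D I g z := by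
    rw [h.D_one_D_one_g hz, k3, ← h.smul_normalField hz, h.D_one_g hz, h.D_I_g hz]
    simp only [cross_add_right, cross_smul_right, cN]
    module
  have gII : D I (D I g) z = (energy f z - hopfRe f g z) • normalField f z
      - (⟪D 1 f z, D 1 (D 1 f) z⟫_ℝ / energy f z) • D 1 g z
      - (⟪D I f z, D 1 (D 1 f) z⟫_ℝ / energy f z) • D I g z := by
    rw [h.D_I_D_I_g hz, k3, ← h.smul_normalField hz, h.D_one_g hz, h.D_I_g hz]
    simp only [cross_add_right, cross_smul_right, cN]
    module
  have g1I : D 1 (D I g) z = hopfIm f g z • normalField f z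
      - (⟪D I f z, D 1 (D 1 f) z⟫_ℝ / energy f z) • D 1 g z
      + (⟪D 1 f z, D 1 (D 1 f) z⟫_ℝ / energy f z) • D I g z := by
    have := congrArg (cross (f z)) k2
    simp only [cross_sub_right, cross_add_right, cross_smul_right, cN, cross_self] at this
    rw [h.D_one_D_I_g hz, this, h.D_one_g hz, h.D_I_g hz]
    module
  have z1 : D 1 (projSq f g u) z = 0 := by
    rw [h.D_projSq hz, g11, g1I, h.D_one_normalField hP hz, h.D_energy hz]
    simp only [inner_add_left, inner_sub_left, real_inner_smul_left]
    field_simp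
    ring
  have zI : D I (projSq f g u) z = 0 := by
    rw [h.D_projSq hz, D_comm h.isOpen h.smooth' hz I 1, gII, g1I, h.D_I_normalField hP hz,
      h.D_energy hz, h.D_I_D_one hz, h.inner_one_D_one_I hz]
    simp only [inner_add_left, inner_sub_left, real_inner_smul_left]
    field_simp
    ring
  rw [D_eq, z1, zI]
  simp

/-! ### Surfaces in a coassociative plane -/

section Coassociative

variable {W : Submodule ℝ R7}

theorem D_g_mem (h : IsLocalPair U f g) (hW : IsCoassociative W) (hf : ∀ z ∈ U, f z ∈ W)
    (hz : z ∈ U) (v : ℂ) : D v g z ∈ Wᗮ := by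
  rw [h.deriv_eq z hz]
  exact hW.cross_mem (hf z hz) (D_mem h.isOpen h.smooth hf hz _)

theorem normalField_mem (h : IsLocalPair U f g) (hW : IsCoassociative W) (hf : ∀ z ∈ U, f z ∈ W)
    (hz : z ∈ U) : normalField f z ∈ Wᗮ :=
  Submodule.smul_mem _ _ (hW.cross_mem (D_mem h.isOpen h.smooth hf hz _)
    (D_mem h.isOpen h.smooth hf hz _))

/-- `N` stays in `Wᗮ`, so its derivative does too, and the derivative is orthogonal to `N`. In the
three-space `Wᗮ` only the tangent plane of `g` is left. -/
theorem hasParallelNormalField (h : IsLocalPair U f g) (hW : IsCoassociative W)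
    (hf : ∀ z ∈ U, f z ∈ W) : HasParallelNormalField U f g := by
  intro z hz v
  have F := h.frame hz
  have hE := h.energy_ne hz
  set x := D v (normalField f) z with hx
  have hxW : x ∈ Wᗮ := D_mem h.isOpen h.smooth_normalField
    (fun ζ hζ => h.normalField_mem hW hf hζ) hz v
  refine ⟨⟨⟪D 1 g z, x⟫_ℝ / energy f z, ⟪D I g z, x⟫_ℝ / energy f z⟩, ?_⟩
  rw [← sub_eq_zero]
  have fW := hf z hz
  have aW := D_mem h.isOpen h.smooth hf hz 1
  have bW := D_mem h.isOpen h.smooth hf hz I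
  have hN : ⟪cross (D 1 f z) (D I f z), x⟫_ℝ = 0 := by
    rw [← h.smul_normalField hz, real_inner_smul_left, h.inner_D_normalField_self hz, mul_zero]
  have hN' : ∀ w, ⟪cross (D 1 f z) (D I f z), D w g z⟫_ℝ = 0 := fun w => by
    rw [← h.smul_normalField hz, real_inner_smul_left, real_inner_comm,
      h.inner_D_g_normalField hz, mul_zero]
  refine F.eq_zero_of_mem hW.1 (hW.cross_mem fW aW) (hW.cross_mem fW bW) (hW.cross_mem aW bW)
    (sub_mem (h.D_g_mem hW hf hz _) hxW) ?_ ?_ ?_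
  · have e : cross (f z) (D 1 f z) = -D I g z := by rw [h.D_I_g hz, neg_neg]
    rw [D_eq g, e, inner_neg_left, inner_sub_right, inner_add_right, real_inner_smul_right,
      real_inner_smul_right, h.inner_g_I_I hz, real_inner_comm (D 1 g z) (D I g z),
      h.inner_g_one_I hz]
    simp only
    field_simp
    ring
  · rw [D_eq g, ← h.D_one_g hz, inner_sub_right, inner_add_right, real_inner_smul_right,
      real_inner_smul_right, h.inner_g_one_one hz, h.inner_g_one_I hz]
    simp only
    field_simp
    ring
  · rw [inner_sub_right, hN, hN', sub_zero]

/-- In the three-sphere of `W` the second fundamental form of `f` is measured by pairing `f × f_xx`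
and `f × f_xy` with `N`, which yields `-R` and `P`. When both vanish `f` is totally geodesic there.
-/
theorem structure_eq_of_umbilic (h : IsLocalPair U f g) (hW : IsCoassociative W)
    (hf : ∀ z ∈ U, f z ∈ W) (hz : z ∈ U) (h1 : hopfRe f g z = 0) (h2 : hopfIm f g z = 0) :
    D 1 (D 1 f) z = -energy f z • f z + (⟪D 1 f z, D 1 (D 1 f) z⟫_ℝ / energy f z) • D 1 f z
      + (⟪D I f z, D 1 (D 1 f) z⟫_ℝ / energy f z) • D I f z ∧
    D 1 (D I f) z = -(⟪D I f z, D 1 (D 1 f) z⟫_ℝ / energy f z) • D 1 f z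
      + (⟪D 1 f z, D 1 (D 1 f) z⟫_ℝ / energy f z) • D I f z := by
  have F := h.frame hz
  have hE := h.energy_ne hz
  have fW := hf z hz
  have dW := fun v => fun ζ hζ => D_mem h.isOpen h.smooth hf (z := ζ) hζ v
  have ddW := fun u v => D_mem h.isOpen (h.smooth_D v) (dW v) hz u
  constructor
  · have h0 : ⟪cross (f z) (D 1 (D 1 f) z), cross (D 1 f z) (D I f z)⟫_ℝ = 0 := by
      rw [hopfIm, h.D_one_D_I_g hz, inner_neg_left, neg_eq_zero] at h2
      rw [← h.smul_normalField hz, real_inner_smul_right, h2, mul_zero]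
    have := F.eq_combination hW fW (dW 1 z hz) (dW I z hz) (ddW 1 1) h0
    rwa [h.inner_self_D_D hz] at this
  · have h0 : ⟪cross (f z) (D 1 (D I f) z), cross (D 1 f z) (D I f z)⟫_ℝ = 0 := by
      rw [hopfRe, h.D_one_D_one_g hz, inner_add_left, ← h.smul_normalField hz,
        real_inner_smul_left, h.inner_normalField_self hz] at h1
      rw [← h.smul_normalField hz, real_inner_smul_right]
      linear_combination energy f z * h1
    have := F.eq_combination hW fW (dW 1 z hz) (dW I z hz) (ddW 1 I) h0
    rw [h.inner_self_D_D hz, h.inner_one_D_one_I hz, h.inner_I_D_one_I hz, h.inner_eq z hz] at this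
    nth_rw 1 [this]
    module

end Coassociative

end IsLocalPair

/-! ### Steps of the harmonic sequence -/

theorem dz_congr {s t : ℂ → C7} {z : ℂ} (h : s =ᶠ[𝓝 z] t) : dz s z = dz t z := by
  rw [dz, dz, h.fderiv_eq]

theorem dz_smul {k : ℂ → ℂ} {s : ℂ → C7} {z : ℂ} (hk : DifferentiableAt ℝ k z)
    (hs : DifferentiableAt ℝ s z) : dz (fun ζ => k ζ • s ζ) z =
      k z • dz s z + (1 / 2 * (fderiv ℝ k z 1 - I * fderiv ℝ k z I)) • s z := by
  rw [dz, dz, fderiv_fun_smul hk hs]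
  simp only [add_apply, smul_apply,
    ContinuousLinearMap.smulRight_apply]
  module

/-- The image of the second fundamental form of a line bundle with a nonvanishing section. -/
theorem imageA_eq_span {L : ℂ → Submodule ℂ C7} {s : ℂ → C7} {z : ℂ} {c : ℂ} {t : C7}
    (hL : ∀ᶠ ζ in 𝓝 z, L ζ = Submodule.span ℂ {s ζ}) (hs : ContDiffAt ℝ ∞ s z) (h0 : s z ≠ 0)
    (hd : dz s z = c • s z + t) (ht : ⟪s z, t⟫_ℂ = 0) : imageA L z = Submodule.span ℂ {t} := by
  have hLz : L z = Submodule.span ℂ {s z} := hL.self_of_nhds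
  have ps : (L z)ᗮ.starProjection (s z) = 0 := by
    rw [Submodule.starProjection_apply_eq_zero_iff, Submodule.orthogonal_orthogonal, hLz]
    exact Submodule.mem_span_singleton_self _
  have pt : (L z)ᗮ.starProjection t = t := by
    rw [Submodule.starProjection_eq_self_iff, hLz, Submodule.mem_orthogonal_singleton_iff_inner_right]
    exact ht
  apply le_antisymm
  · rw [imageA, Submodule.span_le]
    rintro w ⟨σ, hσ, hσL, rfl⟩
    have hss : ⟪s z, s z⟫_ℂ ≠ 0 := by simpa using h0
    have hsd := hs.differentiableAt (by simp)
    have hσd := hσ.differentiableAt (by simp)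
    have hk : DifferentiableAt ℝ (fun ζ => ⟪s ζ, σ ζ⟫_ℂ * (⟪s ζ, s ζ⟫_ℂ)⁻¹) z :=
      (hsd.inner ℂ hσd).fun_mul ((hsd.inner ℂ hsd).inv hss)
    -- Every section is a differentiable multiple of `s`; the derivative of the factor only
    -- contributes along `s` and is projected away.
    have he : σ =ᶠ[𝓝 z] fun ζ => (⟪s ζ, σ ζ⟫_ℂ * (⟪s ζ, s ζ⟫_ℂ)⁻¹) • s ζ := by
      filter_upwards [hL, hσL, hs.continuousAt.eventually_ne h0] with ζ h1 h2 h3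
      rw [h1] at h2
      obtain ⟨a, ha⟩ := Submodule.mem_span_singleton.1 h2
      have h4 : ⟪s ζ, s ζ⟫_ℂ ≠ 0 := by simpa using h3
      rw [← ha, inner_smul_right, mul_assoc, mul_inv_cancel₀ h4, mul_one]
    rw [dz_congr he, dz_smul hk hsd, hd, map_add, map_smul, map_smul, map_add, map_smul, ps, pt]
    simp only [smul_zero, zero_add, add_zero]
    exact Submodule.smul_mem _ _ (Submodule.mem_span_singleton_self t)
  · rw [Submodule.span_singleton_le_iff_mem]
    refine Submodule.subset_span ⟨s, hs, hL.mono fun ζ h => ?_, ?_⟩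
    · rw [h]; exact Submodule.mem_span_singleton_self _
    · rw [hd, map_add, map_smul, ps, pt, smul_zero, zero_add]

theorem imageA_eq_bot {L : ℂ → Submodule ℂ C7} {z : ℂ} (hL : ∀ᶠ ζ in 𝓝 z, L ζ = ⊥) :
    imageA L z = ⊥ := by
  rw [imageA, Submodule.span_eq_bot]
  rintro w ⟨s, -, hsL, rfl⟩
  have : s =ᶠ[𝓝 z] fun _ => 0 := by
    filter_upwards [hL, hsL] with ζ h1 h2
    rwa [h1, Submodule.mem_bot] at h2
  rw [dz_congr this, dz]
  simp

theorem mem_nextBundle {L : ℂ → Submodule ℂ C7} {z : ℂ} {w : C7} : w ∈ nextBundle L z ↔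
    Filter.Tendsto (fun ζ => (imageA L ζ).starProjection w) (𝓝[≠] z) (𝓝 w) := Iff.rfl

theorem nextBundle_eq_bot {L : ℂ → Submodule ℂ C7} {z : ℂ}
    (hA : ∀ᶠ ζ in 𝓝[≠] z, imageA L ζ = ⊥) : nextBundle L z = ⊥ := by
  rw [Submodule.eq_bot_iff]
  intro w hw
  have h0 : Filter.Tendsto (fun ζ => (imageA L ζ).starProjection w) (𝓝[≠] z) (𝓝 0) := by
    refine tendsto_const_nhds.congr' (hA.mono fun ζ h => ?_)
    simp only [h, Submodule.starProjection_bot]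
    rfl
  exact tendsto_nhds_unique hw h0

/-- Projection onto the line of `t ζ` is continuous in `ζ` as long as `t` does not vanish, so the
limit defining the bundle at `z` is projection onto the line of `t z`. -/
theorem nextBundle_eq_span {L : ℂ → Submodule ℂ C7} {z : ℂ} {t : ℂ → C7}
    (hA : ∀ᶠ ζ in 𝓝[≠] z, imageA L ζ = Submodule.span ℂ {t ζ}) (ht : ContinuousAt t z)
    (h0 : t z ≠ 0) : nextBundle L z = Submodule.span ℂ {t z} := by
  have key : ∀ w, Filter.Tendsto (fun ζ => (imageA L ζ).starProjection w) (𝓝[≠] z)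
      (𝓝 ((Submodule.span ℂ {t z}).starProjection w)) := by
    intro w
    have hin : ContinuousAt (fun ζ => ⟪t ζ, w⟫_ℂ) z := ht.inner continuousAt_const
    have hc : ContinuousAt (fun ζ => (⟪t ζ, w⟫_ℂ / ((‖t ζ‖ ^ 2 : ℝ) : ℂ)) • t ζ) z := by
      refine ContinuousAt.smul (ContinuousAt.div hin ?_ ?_) ht
      · exact Complex.continuous_ofReal.continuousAt.comp (ht.norm.pow 2)
      · simpa using h0
    rw [Submodule.starProjection_singleton]
    refine (hc.tendsto.mono_left nhdsWithin_le_nhds).congr' (hA.mono fun ζ h => ?_)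
    simp only [h]
    rw [Submodule.starProjection_singleton]
    rfl
  ext w
  rw [mem_nextBundle, ← Submodule.starProjection_eq_self_iff]
  exact ⟨fun h => tendsto_nhds_unique (key w) h, fun h => by simpa only [h] using key w⟩

/-- Orthogonality passes to the limit; hence orthogonality relations survive the removal of
singularities without knowing where these lie. -/
theorem inner_nextBundle {L : ℂ → Submodule ℂ C7} {z : ℂ} {u : ℂ → C7}
    (hA : ∀ᶠ ζ in 𝓝[≠] z, ∀ w ∈ imageA L ζ, ⟪u ζ, w⟫_ℂ = 0) (hu : ContinuousAt u z) {w : C7}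
    (hw : w ∈ nextBundle L z) : ⟪u z, w⟫_ℂ = 0 := by
  have h1 : Filter.Tendsto (fun ζ => ⟪u ζ, (imageA L ζ).starProjection w⟫_ℂ) (𝓝[≠] z)
      (𝓝 ⟪u z, w⟫_ℂ) := (hu.tendsto.mono_left nhdsWithin_le_nhds).inner hw
  refine tendsto_nhds_unique h1 (tendsto_const_nhds.congr' (hA.mono fun ζ h => ?_))
  exact (h _ (Submodule.starProjection_apply_mem _ _)).symm

section OpenSet

variable {U : Set ℂ} {L : ℂ → Submodule ℂ C7}

theorem nextBundle_eq_bot_on (hU : IsOpen U) (hA : ∀ z ∈ U, imageA L z = ⊥) :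
    ∀ z ∈ U, nextBundle L z = ⊥ := fun _ hz =>
  nextBundle_eq_bot <| Filter.Eventually.filter_mono nhdsWithin_le_nhds <|
    Filter.mem_of_superset (hU.mem_nhds hz) hA

theorem nextBundle_eq_span_on (hU : IsOpen U) {s t : ℂ → C7} {c k : ℂ → ℂ}
    (hL : ∀ z ∈ U, L z = Submodule.span ℂ {s z}) (hs : ContDiffOn ℝ ∞ s U)
    (h0 : ∀ z ∈ U, s z ≠ 0) (hd : ∀ z ∈ U, dz s z = c z • s z + k z • t z)
    (hk : ∀ z ∈ U, k z ≠ 0) (ht : ContDiffOn ℝ ∞ t U) (ht0 : ∀ z ∈ U, t z ≠ 0)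
    (hst : ∀ z ∈ U, ⟪s z, t z⟫_ℂ = 0) : ∀ z ∈ U, nextBundle L z = Submodule.span ℂ {t z} := by
  intro z hz
  refine nextBundle_eq_span (Filter.Eventually.filter_mono nhdsWithin_le_nhds <|
    Filter.mem_of_superset (hU.mem_nhds hz) fun ζ hζ => ?_)
    (ht.continuousOn.continuousAt (hU.mem_nhds hz)) (ht0 z hz)
  change imageA L ζ = _
  rw [imageA_eq_span (Filter.mem_of_superset (hU.mem_nhds hζ) hL)
    (hs.contDiffAt (hU.mem_nhds hζ)) (h0 ζ hζ) (hd ζ hζ)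
    (by rw [inner_smul_right, hst ζ hζ, mul_zero]),
    Submodule.span_singleton_smul_eq (IsUnit.mk0 _ (hk ζ hζ))]

end OpenSet

/-! ### The harmonic sequence of a conformal harmonic immersion -/

/-- The inclusion of `R7` in `C7` as a real linear map. -/
def toC7L : R7 →L[ℝ] C7 :=
  LinearMap.toContinuousLinearMap
    { toFun := toC7
      map_add' := fun x y => by ext i; simp [toC7]
      map_smul' := fun c x => by ext i; simp [toC7] }

theorem toC7_add (x y : R7) : toC7 (x + y) = toC7 x + toC7 y := toC7L.map_add x y

theorem toC7_sub (x y : R7) : toC7 (x - y) = toC7 x - toC7 y := toC7L.map_sub x y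

theorem toC7_neg (x : R7) : toC7 (-x) = -toC7 x := toC7L.map_neg x

theorem toC7_smul (c : ℝ) (x : R7) : toC7 (c • x) = (c : ℂ) • toC7 x := by
  ext i; simp [toC7]

theorem inner_toC7 (x y : R7) : ⟪toC7 x, toC7 y⟫_ℂ = (⟪x, y⟫_ℝ : ℂ) := by
  simp [toC7, PiLp.inner_apply, mul_comm]

theorem fderiv_toC7 {k : ℂ → R7} {z : ℂ} (hk : DifferentiableAt ℝ k z) (v : ℂ) :
    fderiv ℝ (fun ζ => toC7 (k ζ)) z v = toC7 (D v k z) := by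
  have : HasFDerivAt (fun ζ => toC7 (k ζ)) (toC7L.comp (fderiv ℝ k z)) z :=
    toC7L.hasFDerivAt.comp z hk.hasFDerivAt
  rw [this.fderiv]; rfl

theorem dz_toC7 {k : ℂ → R7} {z : ℂ} (hk : DifferentiableAt ℝ k z) :
    dz (fun ζ => toC7 (k ζ)) z = (1 / 2 : ℂ) • (toC7 (D 1 k z) - I • toC7 (D I k z)) := by
  rw [dz, fderiv_toC7 hk, fderiv_toC7 hk]

/-- Twice the derivative `∂f/∂z`. -/
def holD (f : ℂ → R7) (z : ℂ) : C7 := toC7 (D 1 f z) - I • toC7 (D I f z)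

/-- Twice the derivative `∂f/∂z̄`. -/
def antiD (f : ℂ → R7) (z : ℂ) : C7 := toC7 (D 1 f z) + I • toC7 (D I f z)

theorem contDiffOn_toC7 {k : ℂ → R7} {U : Set ℂ} (hk : ContDiffOn ℝ ∞ k U) :
    ContDiffOn ℝ ∞ (fun ζ => toC7 (k ζ)) U :=
  toC7L.contDiff.comp_contDiffOn hk

theorem dz_add_smul {k l : ℂ → R7} {z c : ℂ} (hk : DifferentiableAt ℝ k z)
    (hl : DifferentiableAt ℝ l z) : dz (fun ζ => toC7 (k ζ) + c • toC7 (l ζ)) z =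
      dz (fun ζ => toC7 (k ζ)) z + c • dz (fun ζ => toC7 (l ζ)) z := by
  have h1 : DifferentiableAt ℝ (fun ζ => toC7 (k ζ)) z := toC7L.differentiableAt.comp z hk
  have h2 : DifferentiableAt ℝ (fun ζ => toC7 (l ζ)) z := toC7L.differentiableAt.comp z hl
  rw [dz, dz, dz, fderiv_fun_add h1 (h2.fun_const_smul c), fderiv_fun_const_smul h2]
  simp only [add_apply, smul_apply]
  module

namespace IsLocalPair

variable {U : Set ℂ} {f g : ℂ → R7} {z : ℂ}

theorem smooth_holD (h : IsLocalPair U f g) : ContDiffOn ℝ ∞ (holD f) U :=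
  (contDiffOn_toC7 (h.smooth_D 1)).sub ((contDiffOn_toC7 (h.smooth_D I)).const_smul I)

theorem smooth_antiD (h : IsLocalPair U f g) : ContDiffOn ℝ ∞ (antiD f) U :=
  (contDiffOn_toC7 (h.smooth_D 1)).add ((contDiffOn_toC7 (h.smooth_D I)).const_smul I)

theorem dz_holD (h : IsLocalPair U f g) (hz : z ∈ U) : dz (holD f) z =
    toC7 (D 1 (D 1 f) z + energy f z • f z) - I • toC7 (D 1 (D I f) z) := by
  have e : holD f = fun ζ => toC7 (D 1 f ζ) + (-I) • toC7 (D I f ζ) := by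
    funext ζ; rw [holD]; module
  rw [e, dz_add_smul (h.diff_D hz 1) (h.diff_D hz I), dz_toC7 (h.diff_D hz 1),
    dz_toC7 (h.diff_D hz I), h.D_I_D_one hz, h.D_I_D_I hz]
  simp only [toC7_add, toC7_sub, toC7_neg, toC7_smul]
  match_scalars <;> ring_nf <;> simp <;> ring

theorem dz_antiD (h : IsLocalPair U f g) (hz : z ∈ U) :
    dz (antiD f) z = -(energy f z : ℂ) • toC7 (f z) := by
  have e : antiD f = fun ζ => toC7 (D 1 f ζ) + I • toC7 (D I f ζ) := rfl
  rw [e, dz_add_smul (h.diff_D hz 1) (h.diff_D hz I), dz_toC7 (h.diff_D hz 1),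
    dz_toC7 (h.diff_D hz I), h.D_I_D_one hz, h.D_I_D_I hz]
  simp only [toC7_sub, toC7_neg, toC7_smul]
  match_scalars <;> ring_nf
  all_goals simp

theorem dz_toC7_self (h : IsLocalPair U f g) (hz : z ∈ U) :
    dz (fun ζ => toC7 (f ζ)) z = (1 / 2 : ℂ) • holD f z := dz_toC7 (h.diff hz)

theorem toC7_ne_zero (h : IsLocalPair U f g) (hz : z ∈ U) : toC7 (f z) ≠ 0 := by
  rw [← inner_self_ne_zero (𝕜 := ℂ), inner_toC7, h.unit z hz]
  simp

theorem inner_toC7_holD (h : IsLocalPair U f g) (hz : z ∈ U) : ⟪toC7 (f z), holD f z⟫_ℂ = 0 := by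
  rw [holD, inner_sub_right, inner_smul_right, inner_toC7, inner_toC7, h.inner_D_self hz,
    h.inner_D_self hz]
  simp

theorem inner_antiD_holD (h : IsLocalPair U f g) (hz : z ∈ U) : ⟪antiD f z, holD f z⟫_ℂ = 0 := by
  have F := h.frame hz
  simp only [holD, antiD, inner_sub_right, inner_add_left, inner_smul_right, inner_smul_left,
    inner_toC7, F.aa, F.bb, F.ab, real_inner_comm (D 1 f z) (D I f z), Complex.conj_I]
  push_cast
  linear_combination (energy f z : ℂ) * Complex.I_mul_I

theorem inner_holD_holD (h : IsLocalPair U f g) (hz : z ∈ U) :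
    ⟪holD f z, holD f z⟫_ℂ = 2 * energy f z := by
  have F := h.frame hz
  simp only [holD, inner_sub_right, inner_sub_left, inner_smul_right, inner_smul_left,
    inner_toC7, F.aa, F.bb, F.ab, real_inner_comm (D 1 f z) (D I f z), Complex.conj_I]
  push_cast
  linear_combination (-energy f z : ℂ) * Complex.I_mul_I

theorem inner_antiD_antiD (h : IsLocalPair U f g) (hz : z ∈ U) :
    ⟪antiD f z, antiD f z⟫_ℂ = 2 * energy f z := by
  have F := h.frame hz
  simp only [antiD, inner_add_right, inner_add_left, inner_smul_right, inner_smul_left,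
    inner_toC7, F.aa, F.bb, F.ab, real_inner_comm (D 1 f z) (D I f z), Complex.conj_I]
  push_cast
  linear_combination (-energy f z : ℂ) * Complex.I_mul_I

theorem holD_ne_zero (h : IsLocalPair U f g) (hz : z ∈ U) : holD f z ≠ 0 := by
  rw [← inner_self_ne_zero (𝕜 := ℂ), h.inner_holD_holD hz]
  simpa using h.energy_ne hz

theorem antiD_ne_zero (h : IsLocalPair U f g) (hz : z ∈ U) : antiD f z ≠ 0 := by
  rw [← inner_self_ne_zero (𝕜 := ℂ), h.inner_antiD_antiD hz]
  simpa using h.energy_ne hz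

theorem inner_toC7_dz_holD (h : IsLocalPair U f g) (hz : z ∈ U) :
    ⟪toC7 (f z), dz (holD f) z⟫_ℂ = 0 := by
  have F := h.frame hz
  rw [h.dz_holD hz, inner_sub_right, inner_smul_right, inner_toC7, inner_toC7, inner_add_right,
    real_inner_smul_right, F.pp, h.inner_self_D_D hz, h.inner_self_D_D hz, F.aa, F.ab]
  simp

/-- The differentiated conformality relation: `f_z` has zero complex bilinear square, so `f_zz` is
bilinearly orthogonal to `f_z`, that is, Hermitian orthogonal to the conjugate `antiD`. -/
theorem inner_antiD_dz_holD (h : IsLocalPair U f g) (hz : z ∈ U) :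
    ⟪antiD f z, dz (holD f) z⟫_ℂ = 0 := by
  have F := h.frame hz
  rw [h.dz_holD hz]
  simp only [antiD, inner_sub_right, inner_add_left, inner_smul_right, inner_smul_left,
    inner_toC7, inner_add_right, real_inner_comm (f z) (D 1 f z),
    real_inner_comm (f z) (D I f z), F.pa, F.pb, h.inner_one_D_one_I hz, h.inner_I_D_one_I hz,
    Complex.conj_I]
  push_cast
  linear_combination (⟪D 1 f z, D 1 (D 1 f) z⟫_ℝ : ℂ) * Complex.I_mul_I

/-! ### Orthogonality of `φ_0` to `φ_1`, `φ_2`, `φ_3`. -/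

theorem harmonicSeq_one (h : IsLocalPair U f g) :
    ∀ z ∈ U, harmonicSeq f 1 z = Submodule.span ℂ {holD f z} :=
  nextBundle_eq_span_on h.isOpen (s := fun ζ => toC7 (f ζ)) (c := 0) (k := fun _ => 1 / 2)
    (fun _ _ => rfl) (contDiffOn_toC7 h.smooth) (fun _ => h.toC7_ne_zero)
    (fun z hz => by simp [h.dz_toC7_self hz]) (fun _ _ => by norm_num) h.smooth_holD
    (fun _ => h.holD_ne_zero) (fun _ => h.inner_toC7_holD)

theorem imageA_harmonicSeq_one (h : IsLocalPair U f g) (hz : z ∈ U) {c : ℂ} {t : C7}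
    (hd : dz (holD f) z = c • holD f z + t) (ht : ⟪holD f z, t⟫_ℂ = 0) :
    imageA (harmonicSeq f 1) z = Submodule.span ℂ {t} :=
  imageA_eq_span (Filter.mem_of_superset (h.isOpen.mem_nhds hz) h.harmonicSeq_one)
    (h.smooth_holD.contDiffAt (h.isOpen.mem_nhds hz)) (h.holD_ne_zero hz) hd ht

theorem inner_imageA_harmonicSeq_one (h : IsLocalPair U f g) (hz : z ∈ U) {u w : C7}
    (hu : ⟪u, holD f z⟫_ℂ = 0) (hu' : ⟪u, dz (holD f) z⟫_ℂ = 0)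
    (hw : w ∈ imageA (harmonicSeq f 1) z) : ⟪u, w⟫_ℂ = 0 := by
  have hne : ⟪holD f z, holD f z⟫_ℂ ≠ 0 := inner_self_ne_zero.2 (h.holD_ne_zero hz)
  -- The Gram–Schmidt coefficient of `dz (holD f)` along `holD f`.
  rw [h.imageA_harmonicSeq_one hz (c := ⟪holD f z, dz (holD f) z⟫_ℂ / ⟪holD f z, holD f z⟫_ℂ)
    (t := dz (holD f) z -
      (⟪holD f z, dz (holD f) z⟫_ℂ / ⟪holD f z, holD f z⟫_ℂ) • holD f z) (by module)
    (by rw [inner_sub_right, inner_smul_right, div_mul_cancel₀ _ hne, sub_self])] at hw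
  obtain ⟨a, rfl⟩ := Submodule.mem_span_singleton.1 hw
  rw [inner_smul_right, inner_sub_right, inner_smul_right, hu, hu']
  simp

theorem inner_harmonicSeq_two (h : IsLocalPair U f g) (hz : z ∈ U) {u : ℂ → C7}
    (hc : ContinuousAt u z) (hu : ∀ z ∈ U, ⟪u z, holD f z⟫_ℂ = 0)
    (hu' : ∀ z ∈ U, ⟪u z, dz (holD f) z⟫_ℂ = 0) {w : C7} (hw : w ∈ harmonicSeq f 2 z) :
    ⟪u z, w⟫_ℂ = 0 :=
  inner_nextBundle (Filter.Eventually.filter_mono nhdsWithin_le_nhds <|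
    Filter.mem_of_superset (h.isOpen.mem_nhds hz) fun ζ hζ _ hw =>
      h.inner_imageA_harmonicSeq_one hζ (hu ζ hζ) (hu' ζ hζ) hw) hc hw

theorem continuousAt_toC7 (h : IsLocalPair U f g) (hz : z ∈ U) :
    ContinuousAt (fun ζ => toC7 (f ζ)) z :=
  (contDiffOn_toC7 h.smooth).continuousOn.continuousAt (h.isOpen.mem_nhds hz)

theorem perp_one (h : IsLocalPair U f g) (hz : z ∈ U) {w : C7} (hw : w ∈ harmonicSeq f 1 z) :
    ⟪toC7 (f z), w⟫_ℂ = 0 := by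
  rw [h.harmonicSeq_one z hz] at hw
  obtain ⟨a, rfl⟩ := Submodule.mem_span_singleton.1 hw
  rw [inner_smul_right, h.inner_toC7_holD hz, mul_zero]

theorem perp_two (h : IsLocalPair U f g) (hz : z ∈ U) {w : C7} (hw : w ∈ harmonicSeq f 2 z) :
    ⟪toC7 (f z), w⟫_ℂ = 0 :=
  h.inner_harmonicSeq_two (u := fun ζ => toC7 (f ζ)) hz (h.continuousAt_toC7 hz)
    (fun _ => h.inner_toC7_holD) (fun _ => h.inner_toC7_dz_holD) hw

/-- For a section `s` of `φ_2`, differentiating `⟪f, s⟫ = 0` along `∂/∂z` moves the derivative to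
the conjugate slot: `⟪f, s_z⟫` is minus the product of `∂f/∂z̄` with `s`. Conformality makes that
product zero. -/
theorem perp_three (h : IsLocalPair U f g) (hz : z ∈ U) {w : C7} (hw : w ∈ harmonicSeq f 3 z) :
    ⟪toC7 (f z), w⟫_ℂ = 0 := by
  refine inner_nextBundle (u := fun ζ => toC7 (f ζ))
    (Filter.Eventually.filter_mono nhdsWithin_le_nhds <|
    Filter.mem_of_superset (h.isOpen.mem_nhds hz) fun ζ hζ w hw => ?_) (h.continuousAt_toC7 hz) hw
  change w ∈ Submodule.span ℂ _ at hw
  induction hw using Submodule.span_induction with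
  | zero => exact inner_zero_right _
  | add x y _ _ hx hy => rw [inner_add_right, hx, hy, add_zero]
  | smul a x _ hx => rw [inner_smul_right, hx, mul_zero]
  | mem w hw =>
    obtain ⟨s, hs, hsL, rfl⟩ := hw
    have hp : (harmonicSeq f 2 ζ)ᗮ.starProjection (toC7 (f ζ)) = toC7 (f ζ) := by
      rw [Submodule.starProjection_eq_self_iff]
      intro x hx
      rw [← inner_conj_symm, h.perp_two hζ hx, map_zero]
    rw [← Submodule.inner_starProjection_left_eq_right, hp]
    have hsd := hs.differentiableAt (by simp)
    have hfd : DifferentiableAt ℝ (fun ξ => toC7 (f ξ)) ζ := toC7L.differentiableAt.comp ζ (h.diff hζ)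
    have h0 : (fun ξ => ⟪toC7 (f ξ), s ξ⟫_ℂ) =ᶠ[𝓝 ζ] fun _ => 0 := by
      filter_upwards [hsL, h.isOpen.mem_nhds hζ] with ξ h1 h2
      exact h.perp_two h2 h1
    have h1 : ∀ v, ⟪toC7 (f ζ), fderiv ℝ s ζ v⟫_ℂ = -⟪toC7 (D v f ζ), s ζ⟫_ℂ := by
      intro v
      have := congrArg (fun l : ℂ →L[ℝ] ℂ => l v) h0.fderiv_eq
      simp only [fderiv_inner_apply ℂ hfd hsd, fderiv_toC7 (h.diff hζ), fderiv_const_apply] at this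
      exact eq_neg_of_add_eq_zero_left this
    have hc : ContinuousAt (antiD f) ζ :=
      h.smooth_antiD.continuousOn.continuousAt (h.isOpen.mem_nhds hζ)
    have h2 : ⟪antiD f ζ, s ζ⟫_ℂ = 0 := h.inner_harmonicSeq_two hζ hc
      (fun _ => h.inner_antiD_holD) (fun _ => h.inner_antiD_dz_holD) hsL.self_of_nhds
    rw [antiD, inner_add_left, inner_smul_left, Complex.conj_I] at h2
    rw [dz, inner_smul_right, inner_sub_right, inner_smul_right, h1, h1]
    linear_combination (-1 / 2 : ℂ) * h2

/-- If the second fundamental form of `f` vanishes, the harmonic sequence of `f` breaks off. -/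
theorem perp_four_of_umbilic (h : IsLocalPair U f g) {W : Submodule ℝ R7} (hW : IsCoassociative W)
    (hf : ∀ z ∈ U, f z ∈ W) (h0 : ∀ z ∈ U, hopfRe f g z = 0 ∧ hopfIm f g z = 0) (hz : z ∈ U)
    {w : C7} (hw : w ∈ harmonicSeq f 4 z) : ⟪toC7 (f z), w⟫_ℂ = 0 := by
  have b1 : ∀ z ∈ U, imageA (harmonicSeq f 1) z = ⊥ := by
    intro z hz
    obtain ⟨k1, k2⟩ := h.structure_eq_of_umbilic hW hf hz (h0 z hz).1 (h0 z hz).2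
    rw [h.imageA_harmonicSeq_one hz (t := 0)
      (c := (⟪D 1 f z, D 1 (D 1 f) z⟫_ℝ / energy f z : ℝ) +
        I * (⟪D I f z, D 1 (D 1 f) z⟫_ℝ / energy f z : ℝ)) ?_ (inner_zero_right _),
      Submodule.span_zero_singleton]
    rw [h.dz_holD hz, holD]
    nth_rw 1 [k1, k2]
    simp only [toC7_add, toC7_smul]
    match_scalars <;> ring_nf
    all_goals simp
  have bot : ∀ L : ℂ → Submodule ℂ C7, (∀ z ∈ U, L z = ⊥) → ∀ z ∈ U, nextBundle L z = ⊥ :=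
    fun L hL => nextBundle_eq_bot_on h.isOpen fun ζ hζ =>
      imageA_eq_bot (Filter.mem_of_superset (h.isOpen.mem_nhds hζ) hL)
  have b4 : harmonicSeq f 4 z = ⊥ := bot _ (bot _ (nextBundle_eq_bot_on h.isOpen b1)) z hz
  rw [b4, Submodule.mem_bot] at hw
  rw [hw, inner_zero_right]

/-- The derivatives of the unit normal `normalField f × f` of `f` in the three-sphere. -/
theorem D_cross_normalField (h : IsLocalPair U f g) (hP : HasParallelNormalField U f g)
    (hz : z ∈ U) :
    D 1 (fun ζ => cross (normalField f ζ) (f ζ)) z =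
      (hopfIm f g z / energy f z) • D 1 f z - (hopfRe f g z / energy f z) • D I f z ∧
    D I (fun ζ => cross (normalField f ζ) (f ζ)) z =
      -(hopfRe f g z / energy f z) • D 1 f z - (hopfIm f g z / energy f z) • D I f z := by
  have F := h.frame hz
  have hE := h.energy_ne hz
  have e1 : cross (D 1 g z) (f z) = D I f z := by
    rw [h.D_one_g hz, cross_comm, F.cross_cross, F.pb]; module
  have e2 : cross (D I g z) (f z) = -D 1 f z := by
    rw [h.D_I_g hz, cross_comm, cross_neg_right, F.cross_cross, F.pa]; module
  have e3 : cross (normalField f z) (D 1 f z) = D I f z := by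
    rw [normalField, cross_smul_left, F.cross_ab_a, inv_smul_smul₀ hE]
  have e4 : cross (normalField f z) (D I f z) = -D 1 f z := by
    rw [normalField, cross_smul_left, F.cross_ab_b, neg_smul, smul_neg, inv_smul_smul₀ hE]
  constructor
  · rw [D_cross (h.diff_normalField hz) (h.diff hz), h.D_one_normalField hP hz, e3]
    simp only [cross_sub_left, cross_smul_left, e1, e2]
    match_scalars <;> field_simp
    all_goals ring
  · rw [D_cross (h.diff_normalField hz) (h.diff hz), h.D_I_normalField hP hz, e4]
    simp only [cross_sub_left, cross_smul_left, e1, e2]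
    match_scalars <;> field_simp
    all_goals ring

theorem mono (h : IsLocalPair U f g) {V : Set ℂ} (hV : IsOpen V) (hVU : V ⊆ U) :
    IsLocalPair V f g where
  isOpen := hV
  smooth := h.smooth.mono hVU
  smooth' := h.smooth'.mono hVU
  unit := fun z hz => h.unit z (hVU hz)
  immersed := fun z hz => h.immersed z (hVU hz)
  norm_eq := fun z hz => h.norm_eq z (hVU hz)
  inner_eq := fun z hz => h.inner_eq z (hVU hz)
  harmonic := fun z hz => h.harmonic z (hVU hz)
  deriv_eq := fun z hz => h.deriv_eq z (hVU hz)

/-- The sequence closes up with period four. With `Y = N × f`, each derivative is a multiple of the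
next vector plus, at the first stage, a tangential term: `f_zz` leads to `-(R + iP) Y`, then `Y_z`
is `(R + iP) / (2E)` times `antiD f`, whose derivative is `-E f`. -/
theorem harmonicSeq_four (h : IsLocalPair U f g) (hP : HasParallelNormalField U f g)
    (hPR : ∀ z ∈ U, hopfRe f g z ^ 2 + hopfIm f g z ^ 2 ≠ 0) :
    ∀ z ∈ U, harmonicSeq f 4 z = Submodule.span ℂ {toC7 (f z)} := by
  set Y : ℂ → R7 := fun ζ => cross (normalField f ζ) (f ζ) with hY
  have hYs : ContDiffOn ℝ ∞ Y U :=
    (crossL.contDiff.comp_contDiffOn h.smooth_normalField).clm_apply h.smooth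
  have hne : ∀ z ∈ U, (hopfIm f g z : ℂ) + I * hopfRe f g z ≠ 0 := by
    intro z hz h0
    have h1 := congrArg Complex.re h0
    have h2 := congrArg Complex.im h0
    simp at h1 h2
    exact hPR z hz (by rw [h1, h2]; ring)
  have hY0 : ∀ z ∈ U, toC7 (Y z) ≠ 0 := by
    intro z hz
    rw [← inner_self_ne_zero (𝕜 := ℂ), inner_toC7, hY]
    simp only
    rw [inner_cross_cross, h.inner_normalField_self hz, h.unit z hz, real_inner_comm,
      (h.structure_eq hP hz (hPR z hz)).1]
    simp
  have hYD : ∀ z ∈ U, ∀ v, ⟪D v f z, Y z⟫_ℝ = 0 := by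
    intro z hz v
    have e := h.inner_D_g_normalField hz (-(I * v))
    rw [h.deriv_eq z hz, mul_neg, ← mul_assoc, Complex.I_mul_I, neg_one_mul, neg_neg,
      inner_cross_rotate, real_inner_comm, inner_cross_rotate] at e
    exact e
  have l2 : ∀ z ∈ U, harmonicSeq f 2 z = Submodule.span ℂ {toC7 (Y z)} := by
    refine nextBundle_eq_span_on h.isOpen h.harmonicSeq_one h.smooth_holD
      (fun _ => h.holD_ne_zero) (c := fun z => (⟪D 1 f z, D 1 (D 1 f) z⟫_ℝ / energy f z : ℝ) +
        I * (⟪D I f z, D 1 (D 1 f) z⟫_ℝ / energy f z : ℝ))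
      (k := fun z => -((hopfIm f g z : ℂ) + I * hopfRe f g z)) (fun z hz => ?_)
      (fun z hz => neg_ne_zero.2 (hne z hz)) (contDiffOn_toC7 hYs) hY0 (fun z hz => ?_)
    · obtain ⟨-, k1, k2⟩ := h.structure_eq hP hz (hPR z hz)
      rw [h.dz_holD hz, holD]
      nth_rw 1 [k1, k2]
      simp only [toC7_add, toC7_sub, toC7_smul, hY]
      match_scalars <;> ring_nf
      all_goals simp
    · rw [holD, inner_sub_left, inner_smul_left, inner_toC7, inner_toC7, hYD z hz, hYD z hz]
      simp
  have l3 : ∀ z ∈ U, harmonicSeq f 3 z = Submodule.span ℂ {antiD f z} := by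
    refine nextBundle_eq_span_on h.isOpen l2 (contDiffOn_toC7 hYs) hY0 (c := 0)
      (k := fun z => ((hopfIm f g z : ℂ) + I * hopfRe f g z) / (2 * energy f z))
      (fun z hz => ?_) (fun z hz => div_ne_zero (hne z hz) ?_) h.smooth_antiD
      (fun _ => h.antiD_ne_zero) (fun z hz => ?_)
    · rw [dz_toC7 (hYs.differentiableAt_of_isOpen h.isOpen hz), (h.D_cross_normalField hP hz).1,
        (h.D_cross_normalField hP hz).2, antiD]
      simp only [toC7_sub, toC7_smul, Pi.zero_apply]
      match_scalars <;> ring_nf <;> simp <;> ring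
    · simpa using h.energy_ne hz
    · rw [antiD, inner_add_right, inner_smul_right, inner_toC7, inner_toC7, real_inner_comm,
        hYD z hz, real_inner_comm, hYD z hz]
      simp
  refine nextBundle_eq_span_on h.isOpen l3 h.smooth_antiD (fun _ => h.antiD_ne_zero) (c := 0)
    (k := fun z => -(energy f z : ℂ)) (fun z hz => ?_) (fun z hz => ?_)
    (contDiffOn_toC7 h.smooth) (fun _ => h.toC7_ne_zero) (fun z hz => ?_)
  · rw [h.dz_antiD hz]; simp
  · simpa using h.energy_ne hz
  · rw [antiD, inner_add_left, inner_smul_left, inner_toC7, inner_toC7, real_inner_comm,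
      h.inner_D_self hz, real_inner_comm, h.inner_D_self hz]
    simp

theorem not_perp_four (h : IsLocalPair U f g) (hP : HasParallelNormalField U f g) (hz : z ∈ U)
    (hPR : hopfRe f g z ^ 2 + hopfIm f g z ^ 2 ≠ 0) :
    ∃ w ∈ harmonicSeq f 4 z, ⟪toC7 (f z), w⟫_ℂ ≠ 0 := by
  -- The periodicity needs a nonvanishing Hopf coefficient throughout an open set, so the pair is
  -- restricted to `V`.
  set V := {ζ | ζ ∈ U ∧ hopfRe f g ζ ^ 2 + hopfIm f g ζ ^ 2 ≠ 0} with hV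
  have hVo : IsOpen V := by
    have hc : ContinuousOn (fun ζ => hopfRe f g ζ ^ 2 + hopfIm f g ζ ^ 2) U :=
      (h.smooth_hopfRe.continuousOn.pow 2).add (h.smooth_hopfIm.continuousOn.pow 2)
    exact hc.isOpen_inter_preimage h.isOpen isOpen_ne
  have hVU : V ⊆ U := fun _ h => h.1
  have h' := h.mono hVo hVU
  refine ⟨toC7 (f z), ?_, ?_⟩
  · rw [h'.harmonicSeq_four (fun ζ hζ => hP ζ (hVU hζ)) (fun ζ hζ => hζ.2) z ⟨hz, hPR⟩]
    exact Submodule.mem_span_singleton_self _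
  · rw [inner_self_ne_zero]
    exact h.toC7_ne_zero hz

end IsLocalPair

/-! ### Coordinate changes -/

section Transition

variable {f g f' g' : ℂ → R7} {z z' c : ℂ}

theorem D_one_of_D_eq (hf : ∀ v, D v f z = D (c * v) f' z') :
    D 1 f z = c.re • D 1 f' z' + c.im • D I f' z' := by
  rw [hf, D_eq, mul_one]

theorem D_I_of_D_eq (hf : ∀ v, D v f z = D (c * v) f' z') :
    D I f z = -c.im • D 1 f' z' + c.re • D I f' z' := by
  rw [hf, D_eq]; simp

theorem energy_of_D_eq {p : R7} {E : ℝ} (F : ConformalFrame p (D 1 f' z') (D I f' z') E)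
    (hf : ∀ v, D v f z = D (c * v) f' z') :
    energy f z = (c.re ^ 2 + c.im ^ 2) * energy f' z' := by
  rw [energy, D_one_of_D_eq hf]
  simp only [inner_add_left, inner_add_right, real_inner_smul_left, real_inner_smul_right, F.aa,
    F.bb, F.ab, real_inner_comm (D 1 f' z') (D I f' z')]
  rw [energy, F.aa]; ring

/-- A change of coordinate with derivative `c` multiplies both `f_x × f_y` and `E` by `|c|²`. -/
theorem normalField_of_D_eq {p : R7} {E : ℝ} (F : ConformalFrame p (D 1 f' z') (D I f' z') E)
    (hE : energy f z ≠ 0) (hf : ∀ v, D v f z = D (c * v) f' z') :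
    normalField f z = normalField f' z' := by
  have e := energy_of_D_eq F hf
  have hc : c.re ^ 2 + c.im ^ 2 ≠ 0 := by
    intro h0; rw [h0, zero_mul] at e; exact hE e
  rw [normalField, e, normalField, D_one_of_D_eq hf, D_I_of_D_eq hf]
  simp only [cross_add_left, cross_add_right, cross_smul_left, cross_smul_right, cross_self]
  rw [cross_comm (D I f' z') (D 1 f' z'), mul_inv]
  match_scalars
  field_simp
  ring

theorem projSq_of_D_eq {p : R7} {E : ℝ} (F : ConformalFrame p (D 1 f' z') (D I f' z') E)
    (hE : energy f z ≠ 0) (hf : ∀ v, D v f z = D (c * v) f' z')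
    (hg : ∀ v, D v g z = D (c * v) g' z') (u : R7) : projSq f g u z = projSq f' g' u z' := by
  have e := energy_of_D_eq F hf
  have hc : c.re ^ 2 + c.im ^ 2 ≠ 0 := by
    intro h0; rw [h0, zero_mul] at e; exact hE e
  rw [projSq, projSq, normalField_of_D_eq F hE hf, e, D_one_of_D_eq hg, D_I_of_D_eq hg, mul_inv]
  simp only [inner_add_left, real_inner_smul_left]
  field_simp
  ring

end Transition

/-! ### Maps of a Riemann surface in charts -/

section Chart

variable {S : Type*} [TopologicalSpace S]

theorem eventually_nhds_of_symm {e : OpenPartialHomeomorph S ℂ} {p : S} (hp : p ∈ e.source)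
    {Q : S → Prop} (h : ∀ᶠ ζ in 𝓝 (e p), Q (e.symm ζ)) : ∀ᶠ q in 𝓝 p, Q q := by
  filter_upwards [(e.continuousAt hp).eventually h, e.open_source.mem_nhds hp] with q h1 h2
  rwa [e.left_inv h2] at h1

theorem eventually_symm {e : OpenPartialHomeomorph S ℂ} {z : ℂ} (hz : z ∈ e.target)
    {Q : S → Prop} (h : ∀ᶠ q in 𝓝 (e.symm z), Q q) : ∀ᶠ ζ in 𝓝 z, Q (e.symm ζ) :=
  (e.continuousAt_symm hz).eventually h

theorem eventually_eq_of_D_eq_zero {X : Type*} [NormedAddCommGroup X] [NormedSpace ℝ X]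
    {G : S → X} {e : OpenPartialHomeomorph S ℂ} {z : ℂ} (hz : z ∈ e.target)
    (h : ∀ᶠ ζ in 𝓝 z, DifferentiableAt ℝ (G ∘ e.symm) ζ ∧ ∀ v, D v (G ∘ e.symm) ζ = 0) :
    ∀ᶠ q in 𝓝 (e.symm z), G q = G (e.symm z) := by
  obtain ⟨ε, hε, hB⟩ := Metric.eventually_nhds_iff_ball.1 h
  refine eventually_nhds_of_symm (e.map_target hz) ?_
  rw [e.right_inv hz]
  filter_upwards [Metric.ball_mem_nhds z hε] with ζ hζ
  exact Metric.isOpen_ball.is_const_of_fderiv_eq_zero (𝕜 := ℝ) (f := G ∘ e.symm)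
    (convex_ball z ε).isPreconnected
    (fun ξ hξ => (hB ξ hξ).1.differentiableWithinAt)
    (fun ξ hξ => ContinuousLinearMap.ext (hB ξ hξ).2) hζ (Metric.mem_ball_self hε)

end Chart

section Surface

variable {S : Type*} [TopologicalSpace S] [ChartedSpace ℂ S]

theorem isManifold_real [IsManifold 𝓘(ℂ) ω S] : IsManifold 𝓘(ℝ, ℂ) ∞ S := by
  refine isManifold_of_contDiffOn _ _ _ fun e e' he he' => ?_
  have h := (mem_groupoid_of_pregroupoid.1
    (HasGroupoid.compatible (G := contDiffGroupoid ω 𝓘(ℂ)) he he')).1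
  exact (ContDiffOn.restrict_scalars ℝ h).of_le le_top

theorem exists_transition [IsManifold 𝓘(ℂ) ω S] {e e' : OpenPartialHomeomorph S ℂ}
    (he : e ∈ atlas ℂ S) (he' : e' ∈ atlas ℂ S) {z : ℂ} (hz : z ∈ e.target)
    (hz' : e.symm z ∈ e'.source) : ∃ c : ℂ, ∀ k : S → R7,
      DifferentiableAt ℝ (k ∘ e'.symm) (e' (e.symm z)) →
      ∀ v, D v (k ∘ e.symm) z = D (c * v) (k ∘ e'.symm) (e' (e.symm z)) := by
  have h := (mem_groupoid_of_pregroupoid.1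
    (HasGroupoid.compatible (G := contDiffGroupoid ω 𝓘(ℂ)) he he')).1
  have h : ContDiffOn ℂ ω (e.symm ≫ₕ e') (e.symm ≫ₕ e').source := by
    simpa [contDiffPregroupoid] using h
  have hzs : z ∈ (e.symm ≫ₕ e').source := by simp [hz, hz']
  have hd : DifferentiableAt ℂ (e.symm ≫ₕ e') z :=
    (h.contDiffAt ((e.symm ≫ₕ e').open_source.mem_nhds hzs)).differentiableAt (by simp)
  refine ⟨deriv (e.symm ≫ₕ e') z, fun k hk v => ?_⟩
  have hev : k ∘ e.symm =ᶠ[𝓝 z] (k ∘ e'.symm) ∘ (e.symm ≫ₕ e') := by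
    filter_upwards [(e.symm ≫ₕ e').open_source.mem_nhds hzs] with ζ hζ
    have : e.symm ζ ∈ e'.source := by simpa using hζ.2
    simp [e'.left_inv this]
  have hτ := (hd.hasFDerivAt.restrictScalars ℝ)
  have hcomp := (HasFDerivAt.comp z (g := k ∘ e'.symm) (f := (e.symm ≫ₕ e')) hk.hasFDerivAt hτ)
  rw [D, hev.fderiv_eq, hcomp.fderiv, D]
  simp [mul_comm]

theorem contDiffOn_comp_symm [IsManifold 𝓘(ℂ) ω S] {X : Type*} [NormedAddCommGroup X]
    [NormedSpace ℝ X] {k : S → X} (hk : ContMDiff 𝓘(ℝ, ℂ) 𝓘(ℝ, X) ∞ k)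
    {e : OpenPartialHomeomorph S ℂ} (he : e ∈ atlas ℂ S) : ContDiffOn ℝ ∞ (k ∘ e.symm) e.target := by
  have := isManifold_real (S := S)
  exact contMDiffOn_iff_contDiffOn.1 (hk.comp_contMDiffOn
    (contMDiffOn_symm_of_mem_maximalAtlas (IsManifold.subset_maximalAtlas he)))

theorem eq_of_D_eq_zero [PreconnectedSpace S] {X : Type*} [NormedAddCommGroup X] [NormedSpace ℝ X]
    {G : S → X} (h : ∀ e ∈ atlas ℂ S, ∀ z ∈ e.target,
      DifferentiableAt ℝ (G ∘ e.symm) z ∧ ∀ v, D v (G ∘ e.symm) z = 0) (p q : S) : G p = G q := by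
  refine ((IsLocallyConstant.iff_eventually_eq G).2 fun p => ?_).apply_eq_of_preconnectedSpace p q
  have hp := mem_chart_source ℂ p
  have := eventually_eq_of_D_eq_zero (G := G) ((chartAt ℂ p).map_source hp)
    (Filter.mem_of_superset ((chartAt ℂ p).open_target.mem_nhds ((chartAt ℂ p).map_source hp))
      (h _ (chart_mem_atlas ℂ p)))
  rwa [(chartAt ℂ p).left_inv hp] at this

variable [IsManifold 𝓘(ℂ) ω S] {φ F : S → R7}

theorem isLocalPair (hφ : IsConformalHarmonicImmersion φ) (hF : IsAssociatedSurface φ F)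
    {e : OpenPartialHomeomorph S ℂ} (he : e ∈ atlas ℂ S) :
    IsLocalPair e.target (φ ∘ e.symm) (F ∘ e.symm) where
  isOpen := e.open_target
  smooth := contDiffOn_comp_symm hφ.smooth he
  smooth' := contDiffOn_comp_symm hF.smooth he
  unit := fun z _ => by
    rw [real_inner_self_eq_norm_sq, Function.comp_apply,
      mem_sphere_zero_iff_norm.1 (hφ.mem_sphere _), one_pow]
  immersed := hφ.immersed e he
  norm_eq := fun z hz => (hφ.conformal e he z hz).1
  inner_eq := fun z hz => (hφ.conformal e he z hz).2
  harmonic := hφ.harmonic e he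
  deriv_eq := hF.deriv_eq e he

/-- The mean curvature vector of the surface associated to `φ`. -/
def unitNormal (φ : S → R7) (p : S) : R7 :=
  normalField (φ ∘ (chartAt ℂ p).symm) (chartAt ℂ p p)

theorem unitNormal_symm (hφ : IsConformalHarmonicImmersion φ) (hF : IsAssociatedSurface φ F)
    {e : OpenPartialHomeomorph S ℂ} (he : e ∈ atlas ℂ S) {z : ℂ} (hz : z ∈ e.target) :
    unitNormal φ (e.symm z) = normalField (φ ∘ e.symm) z := by
  have h := isLocalPair hφ hF he
  have h' := isLocalPair hφ hF (chart_mem_atlas ℂ (e.symm z))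
  have hs := mem_chart_source ℂ (e.symm z)
  have hz' := (chartAt ℂ (e.symm z)).map_source hs
  obtain ⟨c, hc⟩ := exists_transition he (chart_mem_atlas ℂ (e.symm z)) hz hs
  exact (normalField_of_D_eq (h'.frame hz') (h.energy_ne hz) (hc φ (h'.diff hz'))).symm

theorem smooth_unitNormal (hφ : IsConformalHarmonicImmersion φ) (hF : IsAssociatedSurface φ F) :
    ContMDiff 𝓘(ℝ, ℂ) 𝓘(ℝ, R7) ∞ (unitNormal φ) := by
  have := isManifold_real (S := S)
  intro p
  have he := chart_mem_atlas ℂ p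
  have hp := mem_chart_source ℂ p
  have h := isLocalPair hφ hF he
  have h1 : ContMDiffAt 𝓘(ℝ, ℂ) 𝓘(ℝ, R7) ∞ (normalField (φ ∘ (chartAt ℂ p).symm))
      (chartAt ℂ p p) :=
    (h.smooth_normalField.contDiffAt
      (h.isOpen.mem_nhds ((chartAt ℂ p).map_source hp))).contMDiffAt
  refine (h1.comp p (contMDiffAt_of_mem_maximalAtlas
    (IsManifold.subset_maximalAtlas he) hp)).congr_of_eventuallyEq ?_
  filter_upwards [(chartAt ℂ p).open_source.mem_nhds hp] with q hq
  have := unitNormal_symm hφ hF he ((chartAt ℂ p).map_source hq)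
  rwa [(chartAt ℂ p).left_inv hq] at this

theorem projSq_chartAt (hφ : IsConformalHarmonicImmersion φ) (hF : IsAssociatedSurface φ F)
    {e : OpenPartialHomeomorph S ℂ} (he : e ∈ atlas ℂ S) {z : ℂ} (hz : z ∈ e.target) (u : R7) :
    projSq (φ ∘ (chartAt ℂ (e.symm z)).symm) (F ∘ (chartAt ℂ (e.symm z)).symm) u
      (chartAt ℂ (e.symm z) (e.symm z)) = projSq (φ ∘ e.symm) (F ∘ e.symm) u z := by
  have h := isLocalPair hφ hF he
  have h' := isLocalPair hφ hF (chart_mem_atlas ℂ (e.symm z))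
  have hs := mem_chart_source ℂ (e.symm z)
  have hz' := (chartAt ℂ (e.symm z)).map_source hs
  obtain ⟨c, hc⟩ := exists_transition he (chart_mem_atlas ℂ (e.symm z)) hz hs
  exact (projSq_of_D_eq (h'.frame hz') (h.energy_ne hz) (hc φ (h'.diff hz'))
    (hc F (h'.diff' hz')) u).symm

/-! ### Umbilical points -/

theorem hasParallelNormalField_of (hφ : IsConformalHarmonicImmersion φ)
    (hF : IsAssociatedSurface φ F) (hP : HasParallelMeanCurvature F)
    {e : OpenPartialHomeomorph S ℂ} (he : e ∈ atlas ℂ S) :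
    HasParallelNormalField e.target (φ ∘ e.symm) (F ∘ e.symm) := by
  intro z hz v
  have := hP e he z hz v
  rwa [(isLocalPair hφ hF he).D_meanCurv hz, IsLocalPair.normalProj_eq_zero_iff] at this

theorem D_add_unitNormal (hφ : IsConformalHarmonicImmersion φ) (hF : IsAssociatedSurface φ F)
    {e : OpenPartialHomeomorph S ℂ} (he : e ∈ atlas ℂ S) {z : ℂ} (hz : z ∈ e.target) :
    DifferentiableAt ℝ ((fun p => F p + unitNormal φ p) ∘ e.symm) z ∧
    ∀ v, D v ((fun p => F p + unitNormal φ p) ∘ e.symm) z =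
      D v (F ∘ e.symm) z + D v (normalField (φ ∘ e.symm)) z := by
  have h := isLocalPair hφ hF he
  have hE : Set.EqOn ((fun p => F p + unitNormal φ p) ∘ e.symm)
      (fun ζ => (F ∘ e.symm) ζ + normalField (φ ∘ e.symm) ζ) e.target := fun ζ hζ => by
    simp [unitNormal_symm hφ hF he hζ]
  refine ⟨?_, fun v => ?_⟩
  · exact ((h.diff' hz).fun_add (h.diff_normalField hz)).congr_of_eventuallyEq
      (hE.eventuallyEq_of_mem (h.isOpen.mem_nhds hz))
  · rw [D_congr h.isOpen hE hz, D_add (h.diff' hz) (h.diff_normalField hz)]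

/-- If `F` plus its mean curvature vector is locally constant, `F` is pseudo-umbilical. -/
theorem isPseudoUmbilical_of (hφ : IsConformalHarmonicImmersion φ) (hF : IsAssociatedSurface φ F)
    (h0 : ∀ p, ∀ᶠ q in 𝓝 p, F q + unitNormal φ q = F p + unitNormal φ p) :
    IsPseudoUmbilical F := by
  -- `λ = 1`: from `dN = -dF` follows `⟪II(u, v), N⟫ = -⟪F_v, N_u⟫ = ⟪F_u, F_v⟫`.
  refine ⟨fun _ => 1, contMDiff_const, fun e he z hz u v => ?_⟩
  have h := isLocalPair hφ hF he
  have h1 : ∀ v, D v (normalField (φ ∘ e.symm)) z = -D v (F ∘ e.symm) z := by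
    intro v
    have h2 := (D_add_unitNormal hφ hF he hz).2 v
    have h3 : ((fun p => F p + unitNormal φ p) ∘ e.symm) =ᶠ[𝓝 z]
        fun _ => F (e.symm z) + unitNormal φ (e.symm z) := eventually_symm hz (h0 (e.symm z))
    rw [D, h3.fderiv_eq] at h2
    simp only [fderiv_const_apply] at h2
    exact eq_neg_of_add_eq_zero_right h2.symm
  have h2 : secondFF (F ∘ e.symm) z u v = normalProj (F ∘ e.symm) z (D u (D v (F ∘ e.symm)) z) := rfl
  rw [h.meanCurv_eq hz, h2, IsLocalPair.inner_normalProj (h.inner_D_g_normalField hz), one_mul]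
  have h3 := h.inner_D_normalField hz u v
  rw [h1, inner_neg_right, neg_inj, real_inner_comm] at h3
  exact h3.symm

/-- Unique continuation. `F + N` is locally constant near a point exactly when the Hopf coefficient
vanishes near it, and the set of such points is open and closed in the connected surface. -/
theorem frequently_not_umbilic [PreconnectedSpace S] (hφ : IsConformalHarmonicImmersion φ)
    (hF : IsAssociatedSurface φ F) (hP : HasParallelMeanCurvature F) (hU : ¬ IsPseudoUmbilical F)
    {e : OpenPartialHomeomorph S ℂ} (he : e ∈ atlas ℂ S) {z : ℂ} (hz : z ∈ e.target) :
    ∃ᶠ ζ in 𝓝 z, hopfRe (φ ∘ e.symm) (F ∘ e.symm) ζ ^ 2 +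
      hopfIm (φ ∘ e.symm) (F ∘ e.symm) ζ ^ 2 ≠ 0 := by
  set G : S → R7 := fun p => F p + unitNormal φ p with hG
  set A : Set S := {p | ∀ᶠ q in 𝓝 p, G q = G p} with hA
  have hopen : IsOpen A := by
    rw [isOpen_iff_mem_nhds]
    intro p hp
    have hp : ∀ᶠ q in 𝓝 p, G q = G p := hp
    filter_upwards [hp, eventually_eventually_nhds.2 hp] with q h1 h2
    change ∀ᶠ r in 𝓝 q, G r = G q
    rwa [h1]
  have hclosed : IsClosed A := by
    refine isClosed_of_closure_subset fun p hp => ?_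
    have he := chart_mem_atlas ℂ p
    have hps := mem_chart_source ℂ p
    set e := chartAt ℂ p
    have h := isLocalPair hφ hF he
    obtain ⟨ε, hε, hB⟩ := Metric.isOpen_iff.1 e.open_target (e p) (e.map_source hps)
    have hN : e.source ∩ e ⁻¹' Metric.ball (e p) ε ∈ 𝓝 p :=
      (e.isOpen_inter_preimage Metric.isOpen_ball).mem_nhds ⟨hps, Metric.mem_ball_self hε⟩
    obtain ⟨q, ⟨hqs, hqB⟩, hqA⟩ := mem_closure_iff_nhds.1 hp _ hN
    have hq0 : ∀ᶠ ζ in 𝓝 (e q), hopfRe (φ ∘ e.symm) (F ∘ e.symm) ζ = 0 ∧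
        hopfIm (φ ∘ e.symm) (F ∘ e.symm) ζ = 0 := by
      have hqA' : ∀ᶠ r in 𝓝 (e.symm (e q)), G r = G q := by rw [e.left_inv hqs]; exact hqA
      have hc := eventually_symm (e.map_source hqs) hqA'
      filter_upwards [eventually_eventually_nhds.2 hc,
        e.open_target.mem_nhds (e.map_source hqs)] with ζ h1 h2
      refine h.hopf_eq_zero_of_D_eq h2 fun v => ?_
      have h3 := (D_add_unitNormal hφ hF he h2).2 v
      have h4 : G ∘ e.symm =ᶠ[𝓝 ζ] fun _ => G q := h1
      rw [D, h4.fderiv_eq] at h3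
      simp only [fderiv_const_apply] at h3
      exact eq_neg_of_add_eq_zero_right h3.symm
    have hPB := fun ζ (hζ : ζ ∈ Metric.ball (e p) ε) =>
      hasParallelNormalField_of hφ hF hP he ζ (hB hζ)
    have hB0 := fun {ζ} (hζ : ζ ∈ Metric.ball (e p) ε) =>
      (h.mono Metric.isOpen_ball hB).hopf_eq_zero hPB (convex_ball _ ε).isPreconnected hqB hq0 hζ
    have := eventually_eq_of_D_eq_zero (G := G) (e.map_source hps)
      (Filter.mem_of_superset (Metric.ball_mem_nhds _ hε) fun ζ hζ => by
        have hd := D_add_unitNormal hφ hF he (hB hζ)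
        refine ⟨hd.1, fun v => (hd.2 v).trans ?_⟩
        rw [h.D_eq_of_hopf_eq_zero (hasParallelNormalField_of hφ hF hP he) (hB hζ) (hB0 hζ).1
          (hB0 hζ).2, add_neg_cancel])
    rwa [e.left_inv hps] at this
  rcases isClopen_iff.1 ⟨hclosed, hopen⟩ with h0 | h1
  · intro hev
    have h := isLocalPair hφ hF he
    have hm : e.symm z ∈ A := by
      refine eventually_eq_of_D_eq_zero (G := G) hz ?_
      filter_upwards [hev, e.open_target.mem_nhds hz] with ζ h1 h2
      have hd := D_add_unitNormal hφ hF he h2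
      refine ⟨hd.1, fun v => (hd.2 v).trans ?_⟩
      have h3 := (add_eq_zero_iff_of_nonneg (sq_nonneg _) (sq_nonneg _)).1 (not_not.1 h1)
      have h4 := (pow_eq_zero_iff two_ne_zero).1 h3.1
      have h5 := (pow_eq_zero_iff two_ne_zero).1 h3.2
      rw [h.D_eq_of_hopf_eq_zero (hasParallelNormalField_of hφ hF hP he) h2 h4 h5, add_neg_cancel]
    rw [h0] at hm
    exact hm
  · refine absurd (isPseudoUmbilical_of hφ hF fun p => ?_) hU
    have : p ∈ A := h1 ▸ Set.mem_univ p
    exact this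

theorem eq_zero_of_frequently {X : Type*} [NormedAddCommGroup X] {k : ℂ → X} {z : ℂ}
    (hk : ContinuousAt k z) (h0 : ∃ᶠ ζ in 𝓝 z, k ζ = 0) : k z = 0 := by
  by_contra hne
  exact h0 (hk.eventually_ne hne)

end Surface

section Surface

variable {S : Type*} [TopologicalSpace S] [ChartedSpace ℂ S] [IsManifold 𝓘(ℂ) ω S] {φ F : S → R7}

/-! ### From parallel mean curvature vector to a coassociative plane -/

theorem inner_normalField_eq_zero [PreconnectedSpace S] (hφ : IsConformalHarmonicImmersion φ)
    (hF : IsAssociatedSurface φ F) (hP : HasParallelMeanCurvature F) (hU : ¬ IsPseudoUmbilical F)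
    {e : OpenPartialHomeomorph S ℂ} (he : e ∈ atlas ℂ S) {z : ℂ} (hz : z ∈ e.target) :
    ⟪(φ ∘ e.symm) z, normalField (φ ∘ e.symm) z⟫_ℝ = 0 := by
  have h := isLocalPair hφ hF he
  refine eq_zero_of_frequently (k := fun ζ => ⟪(φ ∘ e.symm) ζ, normalField (φ ∘ e.symm) ζ⟫_ℝ)
    ((h.diff hz).continuousAt.inner (h.diff_normalField hz).continuousAt) ?_
  refine ((frequently_not_umbilic hφ hF hP hU he hz).and_eventually
    (h.isOpen.mem_nhds hz)).mono fun ζ hζ => ?_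
  exact (h.structure_eq (hasParallelNormalField_of hφ hF hP he) hζ.2 hζ.1).1

/-- The derivative vanishes at the non-umbilical points, which accumulate everywhere, and it is
continuous. Testing with all `u` this says that the span of `g_x`, `g_y`, `N` is a constant
subspace. -/
theorem projSq_const [PreconnectedSpace S] (hφ : IsConformalHarmonicImmersion φ)
    (hF : IsAssociatedSurface φ F) (hP : HasParallelMeanCurvature F) (hU : ¬ IsPseudoUmbilical F)
    (u : R7) (p q : S) :
    projSq (φ ∘ (chartAt ℂ p).symm) (F ∘ (chartAt ℂ p).symm) u (chartAt ℂ p p) =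
    projSq (φ ∘ (chartAt ℂ q).symm) (F ∘ (chartAt ℂ q).symm) u (chartAt ℂ q q) := by
  refine eq_of_D_eq_zero (G := fun p => projSq (φ ∘ (chartAt ℂ p).symm) (F ∘ (chartAt ℂ p).symm) u
    (chartAt ℂ p p)) (fun e he z hz => ?_) p q
  have h := isLocalPair hφ hF he
  have hE := fun ζ (hζ : ζ ∈ e.target) => projSq_chartAt hφ hF he hζ u
  have hd := (h.smooth_projSq u).differentiableAt_of_isOpen h.isOpen hz
  refine ⟨hd.congr_of_eventuallyEq (Set.EqOn.eventuallyEq_of_mem hE (h.isOpen.mem_nhds hz)),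
    fun v => (D_congr h.isOpen hE hz v).trans ?_⟩
  refine eq_zero_of_frequently (contDiffOn_D h.isOpen (h.smooth_projSq u) v
    |>.continuousOn.continuousAt (h.isOpen.mem_nhds hz)) ?_
  refine ((frequently_not_umbilic hφ hF hP hU he hz).and_eventually
    (h.isOpen.mem_nhds hz)).mono fun ζ hζ => ?_
  exact h.D_projSq_eq_zero (hasParallelNormalField_of hφ hF hP he) hζ.2 hζ.1 u v

theorem exists_coassociative [ConnectedSpace S] (hφ : IsConformalHarmonicImmersion φ)
    (hF : IsAssociatedSurface φ F) (hP : HasParallelMeanCurvature F) (hU : ¬ IsPseudoUmbilical F) :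
    ∃ W : Submodule ℝ R7, IsCoassociative W ∧ ∀ p, φ p ∈ W := by
  obtain ⟨p₀⟩ : Nonempty S := inferInstance
  have he := chart_mem_atlas ℂ p₀
  have hz := (chartAt ℂ p₀).map_source (mem_chart_source ℂ p₀)
  have h := isLocalPair hφ hF he
  have hE := h.energy_ne hz
  have fr := h.frame hz
  have hN := h.smul_normalField hz
  have h0 := inner_normalField_eq_zero hφ hF hP hU he hz
  have h0' : ⟪(φ ∘ (chartAt ℂ p₀).symm) (chartAt ℂ p₀ p₀),
      cross (D 1 (φ ∘ (chartAt ℂ p₀).symm) (chartAt ℂ p₀ p₀))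
        (D I (φ ∘ (chartAt ℂ p₀).symm) (chartAt ℂ p₀ p₀))⟫_ℝ = 0 := by
    rw [← hN, real_inner_smul_right, h0, mul_zero]
  have hA := fr.isAssociative h0'
  refine ⟨_, hA.isCoassociative_orthogonal, fun p => ?_⟩
  -- `φ p` is orthogonal to the span at `p`. Using it as the test vector and moving to `p₀` shows
  -- that it is orthogonal to the span at `p₀`.
  have hp0 : projSq (φ ∘ (chartAt ℂ p).symm) (F ∘ (chartAt ℂ p).symm) (φ p) (chartAt ℂ p p) = 0 := by
    have hs := mem_chart_source ℂ p
    have hz := (chartAt ℂ p).map_source hs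
    have h := isLocalPair hφ hF (chart_mem_atlas ℂ p)
    have e : φ p = (φ ∘ (chartAt ℂ p).symm) (chartAt ℂ p p) := by simp [(chartAt ℂ p).left_inv hs]
    have e1 := inner_normalField_eq_zero hφ hF hP hU (chart_mem_atlas ℂ p) hz
    rw [real_inner_comm] at e1
    rw [projSq, e, e1, h.D_one_g hz, h.D_I_g hz, inner_neg_left, inner_cross_self_left,
      inner_cross_self_left]
    ring
  rw [projSq_const hφ hF hP hU (φ p) p p₀, projSq] at hp0
  have hpos := inv_pos.2 fr.pos
  have hp1 := (add_eq_zero_iff_of_nonneg (mul_nonneg hpos.le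
    (add_nonneg (mul_self_nonneg _) (mul_self_nonneg _))) (mul_self_nonneg _)).1 hp0
  have hp2 := (add_eq_zero_iff_of_nonneg (mul_self_nonneg _) (mul_self_nonneg _)).1
    ((mul_eq_zero.1 hp1.1).resolve_left hpos.ne')
  have k1 := mul_self_eq_zero.1 hp2.1
  have k2 := mul_self_eq_zero.1 hp2.2
  have k3 := mul_self_eq_zero.1 hp1.2
  rw [h.D_one_g hz] at k1
  rw [h.D_I_g hz, inner_neg_left, neg_eq_zero] at k2
  rw [Submodule.mem_orthogonal]
  intro x hx
  obtain ⟨a, b, c, rfl⟩ := Submodule.mem_span_triple.1 hx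
  rw [inner_add_left, inner_add_left, real_inner_smul_left, real_inner_smul_left,
    real_inner_smul_left, k1, k2, ← hN, real_inner_smul_left, k3]
  ring

theorem exists_isSuperconformalIn [ConnectedSpace S] (hφ : IsConformalHarmonicImmersion φ)
    (hF : IsAssociatedSurface φ F) (hP : HasParallelMeanCurvature F) (hU : ¬ IsPseudoUmbilical F) :
    ∃ W : Submodule ℝ R7, IsCoassociative W ∧ IsSuperconformalIn φ W := by
  obtain ⟨W, hW, hφW⟩ := exists_coassociative hφ hF hP hU
  refine ⟨W, hW, hφW, 3, hW.finrank_eq, by norm_num, fun i hi0 hi3 => ?_, fun h4 => ?_⟩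
  · intro e he z hz w hw
    have h := isLocalPair hφ hF he
    obtain rfl | rfl | rfl : i = 1 ∨ i = 2 ∨ i = 3 := by omega
    · exact h.perp_one hz hw
    · exact h.perp_two hz hw
    · exact h.perp_three hz hw
  · obtain ⟨p₀⟩ : Nonempty S := inferInstance
    have he := chart_mem_atlas ℂ p₀
    have hz := (chartAt ℂ p₀).map_source (mem_chart_source ℂ p₀)
    have h := isLocalPair hφ hF he
    obtain ⟨ζ, h1, h2⟩ := ((frequently_not_umbilic hφ hF hP hU he hz).and_eventually
      (h.isOpen.mem_nhds hz)).exists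
    obtain ⟨w, hw, hne⟩ := h.not_perp_four (hasParallelNormalField_of hφ hF hP he) h2 h1
    exact hne (h4 _ he ζ h2 w hw)

/-! ### Surfaces of constant mean curvature from a coassociative plane -/

variable {W : Submodule ℝ R7}

theorem hasParallelMeanCurvature (hφ : IsConformalHarmonicImmersion φ)
    (hF : IsAssociatedSurface φ F) (hW : IsCoassociative W) (hφW : ∀ p, φ p ∈ W) :
    HasParallelMeanCurvature F := by
  intro e he z hz v
  have h := isLocalPair hφ hF he
  rw [h.D_meanCurv hz, IsLocalPair.normalProj_eq_zero_iff]
  exact h.hasParallelNormalField hW (fun ζ _ => hφW _) z hz v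

/-- The Hopf coefficient is the trace-free part of `⟪II, N⟫` in a conformal coordinate. -/
theorem hopf_eq_zero_of_isPseudoUmbilical (hφ : IsConformalHarmonicImmersion φ)
    (hF : IsAssociatedSurface φ F) (hU : IsPseudoUmbilical F)
    {e : OpenPartialHomeomorph S ℂ} (he : e ∈ atlas ℂ S) {z : ℂ} (hz : z ∈ e.target) :
    hopfRe (φ ∘ e.symm) (F ∘ e.symm) z = 0 ∧ hopfIm (φ ∘ e.symm) (F ∘ e.symm) z = 0 := by
  obtain ⟨lam, -, hl⟩ := hU
  have h := isLocalPair hφ hF he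
  have key : ∀ u v, ⟪D u (D v (F ∘ e.symm)) z, normalField (φ ∘ e.symm) z⟫_ℝ =
      lam (e.symm z) * ⟪D u (F ∘ e.symm) z, D v (F ∘ e.symm) z⟫_ℝ := by
    intro u v
    have h1 := hl e he z hz u v
    rw [h.meanCurv_eq hz] at h1
    rw [← IsLocalPair.inner_normalProj (h.inner_D_g_normalField hz)]
    exact h1
  have k1 := key 1 1
  have k2 := key I I
  have k3 := key 1 I
  rw [h.inner_g_one_one hz] at k1
  rw [h.inner_g_I_I hz, h.inner_D_I_D_I_g hz] at k2
  rw [h.inner_g_one_I hz, mul_zero] at k3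
  refine ⟨?_, k3⟩
  rw [hopfRe] at k2 ⊢
  linarith

theorem not_isPseudoUmbilical (hφ : IsConformalHarmonicImmersion φ)
    (hF : IsAssociatedSurface φ F) (hW : IsCoassociative W) (hs : IsSuperconformalIn φ W) :
    ¬ IsPseudoUmbilical F := by
  intro hU
  obtain ⟨hφW, m, hm, -, -, h4⟩ := hs
  -- Because `W` has dimension `4 = m + 1`, the failing orthogonality is the one with `φ_4`.
  obtain rfl : m = 3 := by have := hW.finrank_eq; omega
  refine h4 fun e he z hz w hw => ?_
  exact (isLocalPair hφ hF he).perp_four_of_umbilic hW (fun ζ _ => hφW _)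
    (fun ζ hζ => hopf_eq_zero_of_isPseudoUmbilical hφ hF hU he hζ) hz hw

theorem isCMCInUpToTranslation [ConnectedSpace S] (hφ : IsConformalHarmonicImmersion φ)
    (hF : IsAssociatedSurface φ F) (hW : IsCoassociative W) (hφW : ∀ p, φ p ∈ W) :
    IsCMCInUpToTranslation F Wᗮ := by
  obtain ⟨p₀⟩ : Nonempty S := inferInstance
  refine ⟨hW.1, fun e he z hz => (isLocalPair hφ hF he).injective_fderiv_g hz,
    ⟨F p₀, fun p => ?_⟩, unitNormal φ, 1, smooth_unitNormal hφ hF, fun p => ?_,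
    fun e he z hz => ⟨fun v => ?_, ?_⟩⟩
  · rw [Submodule.mem_orthogonal]
    intro u hu
    rw [inner_sub_right, sub_eq_zero]
    refine eq_of_D_eq_zero (G := fun p => ⟪u, F p⟫_ℝ) (fun e he z hz => ?_) p p₀
    have h := isLocalPair hφ hF he
    refine ⟨(differentiableAt_const u).inner ℝ (h.diff' hz), fun v => ?_⟩
    have := D_inner (differentiableAt_const u) (h.diff' hz) v
    rw [D_const, inner_zero_left, zero_add,
      Submodule.inner_right_of_mem_orthogonal hu (h.D_g_mem hW (fun ζ _ => hφW _) hz v)] at this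
    exact this
  · have h := isLocalPair hφ hF (chart_mem_atlas ℂ p)
    have hz := (chartAt ℂ p).map_source (mem_chart_source ℂ p)
    refine ⟨h.normalField_mem hW (fun ζ _ => hφW _) hz, ?_⟩
    have := h.inner_normalField_self hz
    rw [real_inner_self_eq_norm_sq] at this
    exact (pow_eq_one_iff_of_nonneg (norm_nonneg _) two_ne_zero).1 this
  · rw [unitNormal_symm hφ hF he hz]
    exact (isLocalPair hφ hF he).inner_D_g_normalField hz v
  · rw [unitNormal_symm hφ hF he hz, one_smul, (isLocalPair hφ hF he).meanCurv_eq hz]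

end Surface

end SevenDim

end

theorem mainTheorem2 {S : Type*} [TopologicalSpace S] [T2Space S] [ConnectedSpace S]
    [ChartedSpace ℂ S] [IsManifold 𝓘(ℂ) ω S]
    (φ F : S → SevenDim.R7)
    (hφ : SevenDim.IsConformalHarmonicImmersion φ)
    (hF : SevenDim.IsAssociatedSurface φ F) :
    ((SevenDim.HasParallelMeanCurvature F ∧ ¬ SevenDim.IsPseudoUmbilical F) ↔
      ∃ W : Submodule ℝ SevenDim.R7,
        SevenDim.IsCoassociative W ∧ SevenDim.IsSuperconformalIn φ W) ∧
    (∀ W : Submodule ℝ SevenDim.R7,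
      SevenDim.IsCoassociative W → SevenDim.IsSuperconformalIn φ W →
        SevenDim.IsAssociative Wᗮ ∧ SevenDim.IsCMCInUpToTranslation F Wᗮ) := by
  refine ⟨⟨fun h => SevenDim.exists_isSuperconformalIn hφ hF h.1 h.2, ?_⟩, ?_⟩
  · rintro ⟨W, hW, hs⟩
    exact ⟨SevenDim.hasParallelMeanCurvature hφ hF hW hs.1,
      SevenDim.not_isPseudoUmbilical hφ hF hW hs⟩
  · intro W hW hs
    exact ⟨hW, SevenDim.isCMCInUpToTranslation hφ hF hW hs.1⟩
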